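/- **Setting.** Let $n,K\ge 1$, let $f_1,\dots,f_n:\mathbb{R}^{d_x}\times\mathbb{R}^{d_y}\to\mathbb{R}$, and $f=\frac1n\sum_{i=1}^n f_i$. Write $z=(x;y)$ and $\nabla g=(\nabla_1 g;\nabla_2 g)$ for the two blocks of a gradient; norms are Euclidean. Assume, for some $L>0$, $A,B\ge 0$, $\mu_2>0$: 1. every $f_i$ is differentiable and $\nabla f_i$ is $L$-Lipschitz; 2. $\frac1n\sum_{i=1}^n\|\nabla_j f_i(z)-\nabla_j f(z)\|^2\le A\|\nabla_j f(z)\|^2+B$ for all $z$ and $j\in\{1,2\}$; 3. for every $x$ the set $\arg\max_{y} f(x;y)$ is non-empty and closed, and $\Phi(x):=\max_{y} f(x;y)$ is bounded below, with $\Phi^*:=\inf_x\Phi(x)$; 4. $\|\nabla_2 f(x;y)\|^2\ge 2\mu_2(\Phi(x)-f(x;y))$ for all $(x;y)$ (that is, $-f(x;\cdot)$ is $\mu_2$-PŁ); in the degenerate case where $f$ does not depend on $y$ (so that every $\mu_2>0$ is admissible) take $\mu_2\le L$. Put $\kappa_2=L/\mu_2$ and $V(x;y)=4(\Phi(x)-\Phi^*)+(\Phi(x)-f(x;y))$.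 **Algorithms.** Given $z_0^1=(x_0^1;y_0^1)$ and $\alpha,\beta$, in each epoch $k=1,\dots,K$ draw a uniformly random permutation $\sigma_k$ of $\{1,\dots,n\}$, independently over epochs, and for $i=1,\dots,n$ set $$x_i^k=x_{i-1}^k-\alpha\nabla_1 f_{\sigma_k(i)}(x_{i-1}^k;y_{i-1}^k),\qquad y_i^k=y_{i-1}^k+\beta\nabla_2 f_{\sigma_k(i)}(x';y_{i-1}^k),$$ where $x'=x_{i-1}^k$ for simSGDA-RR and $x'=x_i^k$ for altSGDA-RR; then $(x_0^{k+1};y_0^{k+1})=(x_n^k;y_n^k)$. **Theorem.** For every constant $c>0$ there is a constant $C>0$ depending only on $c$ (not on the dimensions, $n$, $K$, the functions, $L,A,B,\mu_2$, $r$, $z_0^1$ or $\varepsilon$) such that the following holds in the above setting for both simSGDA-RR and altSGDA-RR. Let $V_1=V(z_0^1)$, $r\ge 14\kappa_2^2$, $\alpha=\beta/r$ and $$\beta=\min\left\{\frac{1}{6L\sqrt{n(n+A)}},\ c\left(\frac{V_1}{L^2Bn^2K}\right)^{1/3}\right\},$$ where the second entry is read as $+\infty$ if $B=0$. Then $\Phi$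 is differentiable and $$\frac1K\sum_{k=1}^K\mathbb{E}\|\nabla\Phi(x_0^k)\|^2\le C\left(\frac{rLV_1}{K}\sqrt{1+\frac An}+r\left(\frac{L^2BV_1^2}{nK^2}\right)^{1/3}\right).$$ Consequently, for every $\varepsilon>0$, the bound $\frac1K\sum_{k=1}^K\mathbb{E}\|\nabla\Phi(x_0^k)\|^2\le\varepsilon^2$ holds as soon as the number $nK$ of gradient evaluations satisfies $$nK\ \ge\ C\,\frac{rLV_1}{\varepsilon^2}\max\left\{\sqrt{n^2+nA},\ \frac{\sqrt{rnB}}{\varepsilon}\right\};$$ in particular as soon as $nK\ge C\,V_1\left(\sqrt{1+A}\;nrL\varepsilon^{-2}+\sqrt{B}\,\sqrt n\,r^{3/2}L\varepsilon^{-3}\right)$, so for fixed $A,B,V_1$ the gradient complexity is $O(nrL\varepsilon^{-2}+\sqrt n\,r^{3/2}L\varepsilon^{-3})$. -/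

import Mathlib

noncomputable section

namespace SGDARR

/-- The joint domain `ℝ^dx × ℝ^dy` with its Euclidean norm and inner product. -/
abbrev Z (dx dy : ℕ) : Type :=
  WithLp 2 (EuclideanSpace ℝ (Fin dx) × EuclideanSpace ℝ (Fin dy))

/-- The point `(x; y)`. -/
abbrev pt {dx dy : ℕ} (x : EuclideanSpace ℝ (Fin dx)) (y : EuclideanSpace ℝ (Fin dy)) :
    Z dx dy :=
  WithLp.toLp 2 (x, y)

/-- The block `∇₁ g` of the gradient `∇ g = (∇₁ g; ∇₂ g)`. -/
def grad₁ {dx dy : ℕ} (g : Z dx dy → ℝ) (z : Z dx dy) : EuclideanSpace ℝ (Fin dx) :=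
  (gradient g z).fst

/-- The block `∇₂ g` of the gradient `∇ g = (∇₁ g; ∇₂ g)`. -/
def grad₂ {dx dy : ℕ} (g : Z dx dy → ℝ) (z : Z dx dy) : EuclideanSpace ℝ (Fin dy) :=
  (gradient g z).snd

/-- The finite-sum objective `f = (1/n) ∑ fᵢ`. -/
def objective {dx dy n : ℕ} (f : Fin n → Z dx dy → ℝ) (z : Z dx dy) : ℝ :=
  (1 / (n : ℝ)) * ∑ i, f i z

/-- `g` is `L`-smooth: differentiable with an `L`-Lipschitz gradient. -/
def IsSmooth {dx dy : ℕ} (L : ℝ) (g : Z dx dy → ℝ) : Prop :=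
  Differentiable ℝ g ∧ ∀ z w : Z dx dy, ‖gradient g z - gradient g w‖ ≤ L * ‖z - w‖

/-- The component gradient variance is bounded by `A ‖∇ⱼ f‖² + B`, for `j = 1, 2`. -/
def BoundedVariance {dx dy n : ℕ} (A B : ℝ) (f : Fin n → Z dx dy → ℝ) : Prop :=
  ∀ z : Z dx dy,
    (1 / (n : ℝ)) * ∑ i, ‖grad₁ (f i) z - grad₁ (objective f) z‖ ^ 2
        ≤ A * ‖grad₁ (objective f) z‖ ^ 2 + B ∧
    (1 / (n : ℝ)) * ∑ i, ‖grad₂ (f i) z - grad₂ (objective f) z‖ ^ 2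
        ≤ A * ‖grad₂ (objective f) z‖ ^ 2 + B

/-- The set of maximizers of `g(x; ·)`. -/
def argmaxY {dx dy : ℕ} (g : Z dx dy → ℝ) (x : EuclideanSpace ℝ (Fin dx)) :
    Set (EuclideanSpace ℝ (Fin dy)) :=
  {y | ∀ y', g (pt x y') ≤ g (pt x y)}

/-- The primal function `Φ(x) = max_y g(x; y)`. -/
def primal {dx dy : ℕ} (g : Z dx dy → ℝ) (x : EuclideanSpace ℝ (Fin dx)) : ℝ :=
  ⨆ y, g (pt x y)

/-- The infimum `Φ^*` of the primal function. -/
def primalInf {dx dy : ℕ} (g : Z dx dy → ℝ) : ℝ :=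
  ⨅ x, primal g x

/-- For every `x` the maximum of `g(x; ·)` is attained, on a closed set, and the primal function
is bounded below. -/
def PrimalWellDefined {dx dy : ℕ} (g : Z dx dy → ℝ) : Prop :=
  (∀ x, (argmaxY g x).Nonempty ∧ IsClosed (argmaxY g x)) ∧ BddBelow (Set.range (primal g))

/-- For every `x`, `-g(x; ·)` satisfies the Polyak-Łojasiewicz inequality with constant `μ`. -/
def PLInY {dx dy : ℕ} (μ : ℝ) (g : Z dx dy → ℝ) : Prop :=
  ∀ x y, 2 * μ * (primal g x - g (pt x y)) ≤ ‖grad₂ g (pt x y)‖ ^ 2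

/-- The potential `V_lam(x; y) = lam (Φ(x) - Φ^*) + (Φ(x) - g(x; y))`. -/
def potential {dx dy : ℕ} (lam : ℝ) (g : Z dx dy → ℝ) (z : Z dx dy) : ℝ :=
  lam * (primal g z.fst - primalInf g) + (primal g z.fst - g z)

/-- Simultaneous or alternating updates. -/
inductive Variant
  | sim
  | alt

/-- One update with the component `g`: the `x`-update is always evaluated at the current point;
the `y`-update uses the old `x` (simultaneous) or the new `x` (alternating). -/
def step {dx dy : ℕ} (v : Variant) (α β : ℝ) (g : Z dx dy → ℝ) (z : Z dx dy) : Z dx dy :=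
  let x' := z.fst - α • grad₁ g z
  match v with
  | Variant.sim => pt x' (z.snd + β • grad₂ g z)
  | Variant.alt => pt x' (z.snd + β • grad₂ g (pt x' z.snd))

/-- The iterates `z_0, …, z_n` of one epoch that starts at `z` and visits the components in the
order `τ 0, …, τ (n - 1)`. -/
def innerIterate {dx dy n : ℕ} (v : Variant) (α β : ℝ) (f : Fin n → Z dx dy → ℝ)
    (τ : Equiv.Perm (Fin n)) (z : Z dx dy) : Fin (n + 1) → Z dx dy :=
  Fin.induction (motive := fun _ => Z dx dy) z (fun i w => step v α β (f (τ i)) w)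

/-- The points at which the epochs start when the `k`-th epoch uses the permutation `σ k`:
with epochs counted from `0`, epoch `k` starts at `epochStart … k.castSucc`. -/
def epochStart {dx dy n K : ℕ} (v : Variant) (α β : ℝ) (f : Fin n → Z dx dy → ℝ)
    (σ : Fin K → Equiv.Perm (Fin n)) (z : Z dx dy) : Fin (K + 1) → Z dx dy :=
  Fin.induction (motive := fun _ => Z dx dy) z
    (fun k w => innerIterate v α β f (σ k) w (Fin.last n))

/-- Expectation of `X(σ_1, …, σ_K)` for independent uniformly random permutations: the average
of `X` over all `K`-tuples of permutations. -/
def expectRR {n K : ℕ} (X : (Fin K → Equiv.Perm (Fin n)) → ℝ) : ℝ :=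
  (∑ σ, X σ) / (Fintype.card (Fin K → Equiv.Perm (Fin n)) : ℝ)

/-- `(1/K) ∑_k 𝔼 ‖∇Φ(x_0^k)‖²` over the `K` epochs. -/
def avgSqGradPrimal {dx dy n : ℕ} (K : ℕ) (v : Variant) (α β : ℝ) (f : Fin n → Z dx dy → ℝ)
    (z : Z dx dy) : ℝ :=
  (1 / (K : ℝ)) * ∑ k : Fin K,
    expectRR fun σ : Fin K → Equiv.Perm (Fin n) =>
      ‖gradient (primal (objective f)) (epochStart v α β f σ z k.castSucc).fst‖ ^ 2

/-- The step size `min {1 / (6 L √(n (n + A))), c (V / (L² B n² K))^(1/3)}`; for `B = 0` the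
second entry is `+∞`. -/
def stepSizeY (c L A B V : ℝ) (n K : ℕ) : ℝ :=
  if B = 0 then 1 / (6 * L * √((n : ℝ) * (n + A)))
  else min (1 / (6 * L * √((n : ℝ) * (n + A))))
    (c * (V / (L ^ 2 * B * (n : ℝ) ^ 2 * K)) ^ (1 / 3 : ℝ))

/-- Number of component gradient evaluations in `K` epochs with `n` components (one component
per inner update). -/
def gradEvals (n K : ℕ) : ℕ := n * K

end SGDARR

end

namespace SGDARR

open scoped RealInnerProductSpace

/-! An epoch is an inexact gradient descent-ascent step on `f` with stepsizes `nα`, `nβ`. The error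
comes from evaluating the components at drifted points (`exists_epoch_eq`), and it is controlled by
partial sums of component gradients frozen at the start of the epoch. Averaged over the permutation,
these are sums sampled without replacement. Distinct draws are non-positively correlated, so the
second moment is at most that of independent draws (`sum_perm_norm_sq_partial_le`).

The potential `4(Φ - Φ*) + (Φ - f)` decreases along such a step (`potential_le_of_inexact_step`).
The obstacle is that `x` moves along `∇₁f` rather than `∇Φ`. The PŁ inequality implies quadratic
growth away from the maximizers, hence `‖∇Φ - ∇₁f‖² ≤ κ²‖∇₂f‖²` (`norm_sq_gradient_primal_sub_le`).
Since `r ≥ 14κ²`, the ascent in `y` pays for this mismatch.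

Taking expectations absorbs the gradient-dependent sampling error and leaves a term of order
`L²n²β³B` per epoch (`sum_potential_epoch_le`). Telescoping over independent epochs and dividing by
`nKα/2` bounds the average of `‖∇Φ‖²` (`avgSqGradPrimal_le`). The second entry of `β` balances `1/β`
against `β²` (`rate_of_stepSizeY`), and solving the rate for `nK` gives the complexity
(`le_sq_of_complexity`). -/

lemma continuous_of_differentiable_real {E : Type*} [NormedAddCommGroup E]
    [InnerProductSpace ℝ E] {g : E → ℝ} (hg : Differentiable ℝ g) : Continuous g :=
  hg.continuous

/-! ### Quadratic bounds from a Lipschitz gradient -/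

section Descent

variable {E : Type*} [NormedAddCommGroup E] [InnerProductSpace ℝ E] [CompleteSpace E]

lemma hasDerivAt_comp_line {g : E → ℝ} (hg : Differentiable ℝ g) (z d : E) (t : ℝ) :
    HasDerivAt (fun s : ℝ => g (z + s • d)) ⟪gradient g (z + t • d), d⟫ t := by
  have h1 : HasDerivAt (fun s : ℝ => z + s • d) d t := by
    simpa using ((hasDerivAt_id t).smul_const d).const_add z
  exact (hg (z + t • d)).hasGradientAt.hasFDerivAt.comp_hasDerivAt t h1

lemma le_quadratic_of_lipschitz_gradient {L : ℝ} {g : E → ℝ} (hg : Differentiable ℝ g)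
    (hL : ∀ z w, ‖gradient g z - gradient g w‖ ≤ L * ‖z - w‖) (z w : E) :
    g w ≤ g z + ⟪gradient g z, w - z⟫ + L / 2 * ‖w - z‖ ^ 2 := by
  set d := w - z with hd
  -- The deficit in the quadratic bound along the segment; by Cauchy-Schwarz and the Lipschitz bound
  -- its derivative is non-positive.
  let φ : ℝ → ℝ := fun t => g (z + t • d) - t * ⟪gradient g z, d⟫ - L / 2 * t ^ 2 * ‖d‖ ^ 2
  have hφ : ∀ t, HasDerivAt φ
      (⟪gradient g (z + t • d), d⟫ - ⟪gradient g z, d⟫ - L * t * ‖d‖ ^ 2) t := by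
    intro t
    have h1 := hasDerivAt_comp_line hg z d t
    have h2 : HasDerivAt (fun s : ℝ => s * ⟪gradient g z, d⟫) ⟪gradient g z, d⟫ t := by
      simpa using (hasDerivAt_id t).mul_const (⟪gradient g z, d⟫ : ℝ)
    have h3 : HasDerivAt (fun s : ℝ => L / 2 * s ^ 2 * ‖d‖ ^ 2) (L * t * ‖d‖ ^ 2) t := by
      have h := ((hasDerivAt_pow 2 t).const_mul (L / 2)).mul_const (‖d‖ ^ 2)
      have e : L / 2 * ((2 : ℕ) * t ^ (2 - 1)) * ‖d‖ ^ 2 = L * t * ‖d‖ ^ 2 := by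
        rw [show (2 - 1 : ℕ) = 1 from rfl]; push_cast; ring
      rwa [e] at h
    exact (h1.sub h2).sub h3
  have hanti : AntitoneOn φ (Set.Icc 0 1) := by
    apply antitoneOn_of_deriv_nonpos (convex_Icc 0 1)
    · exact fun t _ => (hφ t).continuousAt.continuousWithinAt
    · exact fun t _ => (hφ t).differentiableAt.differentiableWithinAt
    · intro t ht
      rw [interior_Icc] at ht
      rw [(hφ t).deriv, ← inner_sub_left]
      have h1 := real_inner_le_norm (gradient g (z + t • d) - gradient g z) d
      have h2 := hL (z + t • d) z
      rw [add_sub_cancel_left, norm_smul, Real.norm_of_nonneg ht.1.le] at h2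
      have h3 := mul_le_mul_of_nonneg_right h2 (norm_nonneg d)
      nlinarith
  have h := hanti (by simp) (by simp) (zero_le_one' ℝ)
  simp only [φ, zero_smul, one_smul, add_zero] at h
  rw [hd, add_sub_cancel] at h
  rw [← hd] at h
  linarith

lemma gradient_neg {g : E → ℝ} (hg : Differentiable ℝ g) (z : E) :
    gradient (fun z => - g z) z = - gradient g z := by
  apply HasGradientAt.gradient
  rw [hasGradientAt_iff_hasFDerivAt, map_neg]
  exact (hg z).hasGradientAt.hasFDerivAt.neg

lemma quadratic_le_of_lipschitz_gradient {L : ℝ} {g : E → ℝ} (hg : Differentiable ℝ g)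
    (hL : ∀ z w, ‖gradient g z - gradient g w‖ ≤ L * ‖z - w‖) (z w : E) :
    g z + ⟪gradient g z, w - z⟫ - L / 2 * ‖w - z‖ ^ 2 ≤ g w := by
  have h := le_quadratic_of_lipschitz_gradient (L := L) hg.neg (fun z w => by
    change ‖gradient (fun z => - g z) z - gradient (fun z => - g z) w‖ ≤ _
    rw [gradient_neg hg, gradient_neg hg, neg_sub_neg, norm_sub_rev]
    exact hL z w) z w
  have h2 : gradient (-g) z = - gradient g z := gradient_neg hg z
  rw [h2, inner_neg_left] at h
  simp only [Pi.neg_apply] at h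
  linarith

lemma hasGradientAt_average {n : ℕ} {f : Fin n → E → ℝ} (hf : ∀ i, Differentiable ℝ (f i))
    (z : E) : HasGradientAt (fun z => (1 / (n : ℝ)) * ∑ i, f i z)
      ((1 / (n : ℝ)) • ∑ i, gradient (f i) z) z := by
  rw [hasGradientAt_iff_hasFDerivAt, map_smul, map_sum]
  exact (HasFDerivAt.fun_sum fun i _ => (hf i z).hasGradientAt.hasFDerivAt).const_mul _

end Descent

/-! ### Block gradients and smoothness of the average -/

section Smooth

variable {dx dy n : ℕ}

lemma norm_sq_eq_blocks (z : Z dx dy) : ‖z‖ ^ 2 = ‖z.fst‖ ^ 2 + ‖z.snd‖ ^ 2 :=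
  WithLp.prod_norm_sq_eq_of_L2 z

lemma inner_gradient_eq_blocks (g : Z dx dy → ℝ) (z w : Z dx dy) :
    ⟪gradient g z, w⟫ = ⟪grad₁ g z, w.fst⟫ + ⟪grad₂ g z, w.snd⟫ :=
  WithLp.prod_inner_apply _ _

lemma norm_fst_le (z : Z dx dy) : ‖z.fst‖ ≤ ‖z‖ := by
  apply le_of_sq_le_sq _ (norm_nonneg z)
  nlinarith [norm_sq_eq_blocks z, sq_nonneg ‖z.snd‖]

lemma norm_snd_le (z : Z dx dy) : ‖z.snd‖ ≤ ‖z‖ := by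
  apply le_of_sq_le_sq _ (norm_nonneg z)
  nlinarith [norm_sq_eq_blocks z, sq_nonneg ‖z.fst‖]

lemma pt_fst_snd (z : Z dx dy) : pt z.fst z.snd = z := rfl

lemma norm_pt_sub_left (x x' : EuclideanSpace ℝ (Fin dx)) (y : EuclideanSpace ℝ (Fin dy)) :
    ‖pt x' y - pt x y‖ = ‖x' - x‖ := by
  have h := norm_sq_eq_blocks (pt x' y - pt x y)
  simp only [WithLp.sub_fst, WithLp.sub_snd] at h
  have h' : ‖pt x' y - pt x y‖ ^ 2 = ‖x' - x‖ ^ 2 := by simpa using h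
  exact (sq_eq_sq₀ (norm_nonneg _) (norm_nonneg _)).1 h'

lemma norm_pt_sub_right (x : EuclideanSpace ℝ (Fin dx)) (y y' : EuclideanSpace ℝ (Fin dy)) :
    ‖pt x y' - pt x y‖ = ‖y' - y‖ := by
  have h := norm_sq_eq_blocks (pt x y' - pt x y)
  simp only [WithLp.sub_fst, WithLp.sub_snd] at h
  have h' : ‖pt x y' - pt x y‖ ^ 2 = ‖y' - y‖ ^ 2 := by simpa using h
  exact (sq_eq_sq₀ (norm_nonneg _) (norm_nonneg _)).1 h'

lemma IsSmooth.norm_grad₁_sub_le {L : ℝ} {g : Z dx dy → ℝ} (hg : IsSmooth L g) (z w : Z dx dy) :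
    ‖grad₁ g z - grad₁ g w‖ ≤ L * ‖z - w‖ :=
  (norm_fst_le (gradient g z - gradient g w)).trans (hg.2 z w)

lemma IsSmooth.norm_grad₂_sub_le {L : ℝ} {g : Z dx dy → ℝ} (hg : IsSmooth L g) (z w : Z dx dy) :
    ‖grad₂ g z - grad₂ g w‖ ≤ L * ‖z - w‖ :=
  (norm_snd_le (gradient g z - gradient g w)).trans (hg.2 z w)

lemma IsSmooth.continuous {L : ℝ} {g : Z dx dy → ℝ} (hg : IsSmooth L g) : Continuous g :=
  continuous_of_differentiable_real hg.1

lemma IsSmooth.le_quadratic {L : ℝ} {g : Z dx dy → ℝ} (hg : IsSmooth L g) (z w : Z dx dy) :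
    g w ≤ g z + ⟪gradient g z, w - z⟫ + L / 2 * ‖w - z‖ ^ 2 :=
  le_quadratic_of_lipschitz_gradient hg.1 hg.2 z w

lemma IsSmooth.quadratic_le {L : ℝ} {g : Z dx dy → ℝ} (hg : IsSmooth L g) (z w : Z dx dy) :
    g z + ⟪gradient g z, w - z⟫ - L / 2 * ‖w - z‖ ^ 2 ≤ g w :=
  quadratic_le_of_lipschitz_gradient hg.1 hg.2 z w

lemma gradient_objective {f : Fin n → Z dx dy → ℝ} (hf : ∀ i, Differentiable ℝ (f i))
    (z : Z dx dy) : HasGradientAt (objective f) ((1 / (n : ℝ)) • ∑ i, gradient (f i) z) z := by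
  exact hasGradientAt_average hf z

lemma grad₁_objective {f : Fin n → Z dx dy → ℝ} (hf : ∀ i, Differentiable ℝ (f i))
    (z : Z dx dy) : grad₁ (objective f) z = (1 / (n : ℝ)) • ∑ i, grad₁ (f i) z := by
  unfold grad₁
  rw [(gradient_objective hf z).gradient]
  have h := map_sum (WithLp.fstL 2 ℝ (EuclideanSpace ℝ (Fin dx)) (EuclideanSpace ℝ (Fin dy)))
    (fun i => gradient (f i) z) Finset.univ
  rw [WithLp.smul_fst]
  exact congrArg _ h

lemma grad₂_objective {f : Fin n → Z dx dy → ℝ} (hf : ∀ i, Differentiable ℝ (f i))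
    (z : Z dx dy) : grad₂ (objective f) z = (1 / (n : ℝ)) • ∑ i, grad₂ (f i) z := by
  unfold grad₂
  rw [(gradient_objective hf z).gradient]
  have h := map_sum (WithLp.sndL 2 ℝ (EuclideanSpace ℝ (Fin dx)) (EuclideanSpace ℝ (Fin dy)))
    (fun i => gradient (f i) z) Finset.univ
  rw [WithLp.smul_snd]
  exact congrArg _ h

lemma isSmooth_objective {L : ℝ} {f : Fin n → Z dx dy → ℝ} (hn : 0 < n)
    (hf : ∀ i, IsSmooth L (f i)) : IsSmooth L (objective f) := by
  have hd := fun i => (hf i).1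
  refine ⟨fun z => (gradient_objective hd z).differentiableAt, fun z w => ?_⟩
  rw [(gradient_objective hd z).gradient, (gradient_objective hd w).gradient, ← smul_sub,
    ← Finset.sum_sub_distrib, norm_smul, Real.norm_of_nonneg (by positivity)]
  have h : ‖∑ i, (gradient (f i) z - gradient (f i) w)‖ ≤ n * (L * ‖z - w‖) := by
    refine (norm_sum_le_of_le _ fun i _ => (hf i).2 z w).trans ?_
    simp
  calc 1 / (n : ℝ) * _ ≤ 1 / (n : ℝ) * (n * (L * ‖z - w‖)) := by gcongr
    _ = L * ‖z - w‖ := by field_simp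

end Smooth

/-! ### Quadratic growth from the PŁ inequality -/

section Growth

variable {E : Type*} [NormedAddCommGroup E] [InnerProductSpace ℝ E] [ProperSpace E]

/-- Linear decrease of `√h` away from its zeros, in the strict form obtained by minimizing
`√h + c ‖· - y‖`. -/
lemma exists_zero_of_pl {h : E → ℝ} {G : E → E} {L μ c : ℝ} (hL : 0 < L) (hc : 0 < c)
    (hcμ : 2 * c ^ 2 < μ) (hcont : Continuous h) (h0 : ∀ y, 0 ≤ h y)
    (hup : ∀ w u, h u ≤ h w + ⟪G w, u - w⟫ + L / 2 * ‖u - w‖ ^ 2)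
    (hpl : ∀ w, 2 * μ * h w ≤ ‖G w‖ ^ 2) (y : E) :
    ∃ w, h w = 0 ∧ c ^ 2 * ‖w - y‖ ^ 2 ≤ h y := by
  have hφ : Continuous fun w => √(h w) + c * ‖w - y‖ := by fun_prop
  -- The sublevel set through `y` lies in the ball of radius `√(h y) / c`, so properness yields a
  -- global minimizer `w`.
  obtain ⟨w, hw⟩ := hφ.exists_forall_le_of_isBounded y (by
    refine (Metric.isBounded_closedBall (x := y) (r := √(h y) / c)).subset fun w hw => ?_
    simp only [Set.mem_ofPred_eq, sub_self, norm_zero, mul_zero, add_zero] at hw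
    rw [Metric.mem_closedBall, dist_eq_norm, le_div_iff₀ hc]
    linarith [Real.sqrt_nonneg (h w)])
  have hslope : ∀ u, √(h w) ≤ √(h u) + c * ‖u - w‖ := by
    intro u
    have h1 := hw u
    have h2 : ‖u - y‖ ≤ ‖u - w‖ + ‖w - y‖ := norm_sub_le_norm_sub_add_norm_sub u w y
    nlinarith
  refine ⟨w, ?_, ?_⟩
  · by_contra hne
    have hpos : 0 < h w := lt_of_le_of_ne (h0 w) (Ne.symm hne)
    set s := √(h w) with hs
    have hs0 : 0 < s := Real.sqrt_pos.2 hpos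
    have hsq : s ^ 2 = h w := Real.sq_sqrt hpos.le
    set a := ‖G w‖ with ha
    have hμ : 0 < μ := by nlinarith [sq_nonneg c]
    have hpl' := hpl w
    rw [← ha, ← hsq] at hpl'
    have ha0 : 0 < a := by
      have : 0 < a ^ 2 := lt_of_lt_of_le (by positivity) hpl'
      exact lt_of_le_of_ne (norm_nonneg _) fun h => by rw [← h] at this; norm_num at this
    -- If `h w > 0`, a gradient step of size `t` lowers `h` by about `t a²`, while `hslope` lets
    -- `√h` fall by at most `c t a`. Small `t` then forces `a ≤ 2cs`, against PŁ because `2c² < μ`.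
    have hstep : ∀ t : ℝ, 0 < t → a - L / 2 * t * a ≤ 2 * c * s := by
      intro t ht
      have h1 := hup w (w - t • G w)
      have h2 := hslope (w - t • G w)
      rw [sub_sub_cancel_left, norm_neg, norm_smul, Real.norm_of_nonneg ht.le, ← ha] at h1 h2
      rw [inner_neg_right, real_inner_smul_right, real_inner_self_eq_norm_sq, ← ha, ← hsq] at h1
      set b := √(h (w - t • G w))
      have hb0 : 0 ≤ b := Real.sqrt_nonneg _
      have hb : b ^ 2 = h (w - t • G w) := Real.sq_sqrt (h0 _)
      rw [← hb] at h1
      have h3 : s ^ 2 - 2 * c * s * (t * a) ≤ b ^ 2 := by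
        have hta : 0 ≤ c * (t * a) := by positivity
        rcases le_total s (c * (t * a)) with hle | hle
        · nlinarith [mul_nonneg hs0.le (sub_nonneg.2 hle)]
        · nlinarith [pow_le_pow_left₀ (sub_nonneg.2 hle) (sub_le_iff_le_add.2 h2) 2]
      have h4 : 0 ≤ (t * a) * (2 * c * s - (a - L / 2 * t * a)) := by nlinarith
      have h5 : 0 < t * a := by positivity
      nlinarith [nonneg_of_mul_nonneg_right h4 h5]
    have hle : a ≤ 2 * c * s := by
      by_contra! hlt
      -- This `t` makes the second-order loss exactly half of the excess `a - 2cs`.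
      have h1 := hstep ((a - 2 * c * s) / (L * a)) (div_pos (by linarith) (by positivity))
      have h2 : L / 2 * ((a - 2 * c * s) / (L * a)) * a = (a - 2 * c * s) / 2 := by field_simp
      rw [h2] at h1
      linarith
    have h1 : a ^ 2 ≤ (2 * c * s) ^ 2 := pow_le_pow_left₀ ha0.le hle 2
    nlinarith [mul_pos hs0 hs0]
  · have h1 := hw y
    simp only [sub_self, norm_zero, mul_zero, add_zero] at h1
    have h2 : c * ‖w - y‖ ≤ √(h y) := by linarith [Real.sqrt_nonneg (h w)]
    have h3 := pow_le_pow_left₀ (by positivity) h2 2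
    rwa [Real.sq_sqrt (h0 y), mul_pow] at h3

end Growth

/-! ### Differentiability of the primal function and its gradient mismatch -/

section Primal

variable {dx dy : ℕ} {g : Z dx dy → ℝ} {L μ : ℝ}

lemma primal_eq_of_mem_argmaxY {x : EuclideanSpace ℝ (Fin dx)} {y : EuclideanSpace ℝ (Fin dy)}
    (hy : y ∈ argmaxY g x) : primal g x = g (pt x y) :=
  le_antisymm (ciSup_le hy) (le_ciSup ⟨g (pt x y), by rintro _ ⟨y', rfl⟩; exact hy y'⟩ y)

lemma le_primal (hne : ∀ x, (argmaxY g x).Nonempty) (x : EuclideanSpace ℝ (Fin dx))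
    (y : EuclideanSpace ℝ (Fin dy)) : g (pt x y) ≤ primal g x := by
  obtain ⟨y', hy'⟩ := hne x
  rw [primal_eq_of_mem_argmaxY hy']
  exact hy' y

lemma mem_argmaxY_of_eq_primal (hne : ∀ x, (argmaxY g x).Nonempty)
    {x : EuclideanSpace ℝ (Fin dx)} {y : EuclideanSpace ℝ (Fin dy)}
    (h : primal g x = g (pt x y)) : y ∈ argmaxY g x := fun y' => h ▸ le_primal hne x y'

lemma IsSmooth.quadratic_le_snd (hg : IsSmooth L g) (x : EuclideanSpace ℝ (Fin dx))
    (y y' : EuclideanSpace ℝ (Fin dy)) :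
    g (pt x y) + ⟪grad₂ g (pt x y), y' - y⟫ - L / 2 * ‖y' - y‖ ^ 2 ≤ g (pt x y') := by
  have h := hg.quadratic_le (pt x y) (pt x y')
  rw [inner_gradient_eq_blocks, norm_pt_sub_right] at h
  simpa using h

lemma IsSmooth.quadratic_le_fst (hg : IsSmooth L g) (x x' : EuclideanSpace ℝ (Fin dx))
    (y : EuclideanSpace ℝ (Fin dy)) :
    g (pt x y) + ⟪grad₁ g (pt x y), x' - x⟫ - L / 2 * ‖x' - x‖ ^ 2 ≤ g (pt x' y) := by
  have h := hg.quadratic_le (pt x y) (pt x' y)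
  rw [inner_gradient_eq_blocks, norm_pt_sub_left] at h
  simpa using h

lemma IsSmooth.le_quadratic_fst (hg : IsSmooth L g) (x x' : EuclideanSpace ℝ (Fin dx))
    (y : EuclideanSpace ℝ (Fin dy)) :
    g (pt x' y) ≤ g (pt x y) + ⟪grad₁ g (pt x y), x' - x⟫ + L / 2 * ‖x' - x‖ ^ 2 := by
  have h := hg.le_quadratic (pt x y) (pt x' y)
  rw [inner_gradient_eq_blocks, norm_pt_sub_left] at h
  simpa using h

/-- An ascent step of length `1/L` in `y` gains at least `‖∇₂g‖² / (2L)` and cannot exceed the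
maximum. -/
lemma norm_sq_grad₂_le (hL : 0 < L) (hg : IsSmooth L g) (hne : ∀ x, (argmaxY g x).Nonempty)
    (x : EuclideanSpace ℝ (Fin dx)) (y : EuclideanSpace ℝ (Fin dy)) :
    ‖grad₂ g (pt x y)‖ ^ 2 ≤ 2 * L * (primal g x - g (pt x y)) := by
  have h := (hg.quadratic_le_snd x y (y + (1 / L) • grad₂ g (pt x y))).trans (le_primal hne _ _)
  rw [add_sub_cancel_left, real_inner_smul_right, real_inner_self_eq_norm_sq, norm_smul,
    Real.norm_of_nonneg (by positivity)] at h
  have e : L / 2 * (1 / L * ‖grad₂ g (pt x y)‖) ^ 2 = 1 / L * ‖grad₂ g (pt x y)‖ ^ 2 / 2 := by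
    field_simp
  have e' : ‖grad₂ g (pt x y)‖ ^ 2 = L * (1 / L * ‖grad₂ g (pt x y)‖ ^ 2) := by field_simp
  rw [e'] at *
  nlinarith

lemma grad₂_eq_zero_of_mem_argmaxY (hL : 0 < L) (hg : IsSmooth L g)
    (hne : ∀ x, (argmaxY g x).Nonempty) {x : EuclideanSpace ℝ (Fin dx)}
    {y : EuclideanSpace ℝ (Fin dy)} (hy : y ∈ argmaxY g x) : grad₂ g (pt x y) = 0 := by
  have h := norm_sq_grad₂_le hL hg hne x y
  rw [primal_eq_of_mem_argmaxY hy, sub_self, mul_zero] at h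
  exact norm_eq_zero.1 (pow_eq_zero_iff (two_ne_zero) |>.1 (le_antisymm h (sq_nonneg _)))

/-- If `μ > L`, PŁ and `norm_sq_grad₂_le` are compatible only with a zero gap everywhere, so `g`
does not depend on `y` and the convention `hconst` applies. -/
lemma le_of_plInY (hL : 0 < L) (hg : IsSmooth L g)
    (hne : ∀ x, (argmaxY g x).Nonempty) (hpl : PLInY μ g)
    (hconst : (∀ x y y', g (pt x y) = g (pt x y')) → μ ≤ L) : μ ≤ L := by
  by_contra! hlt
  refine absurd (hconst fun x => ?_) (not_le.2 hlt)
  have h : ∀ y, primal g x = g (pt x y) := fun y => by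
    have h1 := (hpl x y).trans (norm_sq_grad₂_le hL hg hne x y)
    have h2 := le_primal hne x y
    nlinarith
  exact fun y y' => (h y).symm.trans (h y')

/-- `∇₂g` vanishes at the maximizer over `x`, so it is at most `L‖x' - x‖` over `x'`; PŁ turns this
into a bound on the gap. -/
lemma primal_sub_le (hL : 0 < L) (hμ : 0 < μ) (hg : IsSmooth L g)
    (hne : ∀ x, (argmaxY g x).Nonempty) (hpl : PLInY μ g) {x : EuclideanSpace ℝ (Fin dx)}
    {y : EuclideanSpace ℝ (Fin dy)} (hy : y ∈ argmaxY g x) (x' : EuclideanSpace ℝ (Fin dx)) :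
    primal g x' - g (pt x' y) ≤ L ^ 2 / (2 * μ) * ‖x' - x‖ ^ 2 := by
  have h1 := hg.norm_grad₂_sub_le (pt x' y) (pt x y)
  rw [grad₂_eq_zero_of_mem_argmaxY hL hg hne hy, sub_zero, norm_pt_sub_left] at h1
  have h2 := (hpl x' y).trans (pow_le_pow_left₀ (norm_nonneg _) h1 2)
  rw [div_mul_eq_mul_div, le_div_iff₀ (by positivity)]
  linarith

lemma primal_le_quadratic_of_mem (hL : 0 < L) (hμ : 0 < μ) (hg : IsSmooth L g)
    (hne : ∀ x, (argmaxY g x).Nonempty) (hpl : PLInY μ g) {x : EuclideanSpace ℝ (Fin dx)}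
    {y : EuclideanSpace ℝ (Fin dy)} (hy : y ∈ argmaxY g x) (x' : EuclideanSpace ℝ (Fin dx)) :
    primal g x' ≤ primal g x + ⟪grad₁ g (pt x y), x' - x⟫
      + (L / 2 + L ^ 2 / (2 * μ)) * ‖x' - x‖ ^ 2 := by
  have h1 := primal_sub_le hL hμ hg hne hpl hy x'
  have h2 := hg.le_quadratic_fst x x' y
  rw [primal_eq_of_mem_argmaxY hy]
  linarith

/-- A Danskin-type statement without concavity or uniqueness of the maximizer: `Φ` is squeezed
between `g(·; y)`, which touches it at `x`, and the quadratic upper bound. -/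
lemma hasGradientAt_primal (hL : 0 < L) (hμ : 0 < μ) (hg : IsSmooth L g)
    (hne : ∀ x, (argmaxY g x).Nonempty) (hpl : PLInY μ g) {x : EuclideanSpace ℝ (Fin dx)}
    {y : EuclideanSpace ℝ (Fin dy)} (hy : y ∈ argmaxY g x) :
    HasGradientAt (primal g) (grad₁ g (pt x y)) x := by
  rw [hasGradientAt_iff_isLittleO]
  have hO : (fun x' => primal g x' - primal g x - ⟪grad₁ g (pt x y), x' - x⟫)
      =O[nhds x] fun x' => ‖x' - x‖ ^ 2 := by
    refine Asymptotics.IsBigO.of_bound (L / 2 + L ^ 2 / (2 * μ)) (Filter.Eventually.of_forall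
      fun x' => ?_)
    rw [Real.norm_of_nonneg (sq_nonneg _), Real.norm_eq_abs, abs_le]
    have h1 := primal_le_quadratic_of_mem hL hμ hg hne hpl hy x'
    have h2 := (hg.quadratic_le_fst x x' y).trans (le_primal hne x' y)
    rw [← primal_eq_of_mem_argmaxY hy] at h2
    have h3 : 0 ≤ L ^ 2 / (2 * μ) * ‖x' - x‖ ^ 2 := by positivity
    constructor <;> linarith
  refine hO.trans_isLittleO ?_
  have h0 : Filter.Tendsto (fun x' => ‖x' - x‖) (nhds x) (nhds 0) :=
    tendsto_norm_sub_self x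
  have h1 : (fun x' => ‖x' - x‖) =o[nhds x] fun _ => (1 : ℝ) :=
    (Asymptotics.isLittleO_one_iff ℝ).2 h0
  have h2 : (fun x' => ‖x' - x‖ * ‖x' - x‖) =o[nhds x] fun x' => (1 : ℝ) * ‖x' - x‖ :=
    h1.mul_isBigO (Asymptotics.isBigO_refl _ _)
  simp only [one_mul, ← sq] at h2
  exact h2.of_norm_right

lemma differentiable_primal (hL : 0 < L) (hμ : 0 < μ) (hg : IsSmooth L g)
    (hne : ∀ x, (argmaxY g x).Nonempty) (hpl : PLInY μ g) : Differentiable ℝ (primal g) :=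
  fun x => by
    obtain ⟨y, hy⟩ := hne x
    exact (hasGradientAt_primal hL hμ hg hne hpl hy).differentiableAt

lemma primal_le_quadratic (hL : 0 < L) (hμ : 0 < μ) (hg : IsSmooth L g)
    (hne : ∀ x, (argmaxY g x).Nonempty) (hpl : PLInY μ g) (x x' : EuclideanSpace ℝ (Fin dx)) :
    primal g x' ≤ primal g x + ⟪gradient (primal g) x, x' - x⟫
      + (L / 2 + L ^ 2 / (2 * μ)) * ‖x' - x‖ ^ 2 := by
  obtain ⟨y, hy⟩ := hne x
  rw [(hasGradientAt_primal hL hμ hg hne hpl hy).gradient]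
  exact primal_le_quadratic_of_mem hL hμ hg hne hpl hy x'

lemma exists_mem_argmaxY_near (hL : 0 < L) (hg : IsSmooth L g)
    (hne : ∀ x, (argmaxY g x).Nonempty) (hpl : PLInY μ g) {c : ℝ} (hc : 0 < c)
    (hcμ : 2 * c ^ 2 < μ) (x : EuclideanSpace ℝ (Fin dx)) (y : EuclideanSpace ℝ (Fin dy)) :
    ∃ w ∈ argmaxY g x, c ^ 2 * ‖w - y‖ ^ 2 ≤ primal g x - g (pt x y) := by
  have hpt : Continuous fun y : EuclideanSpace ℝ (Fin dy) => pt x y :=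
    (WithLp.prod_continuous_toLp 2 _ _).comp (by fun_prop)
  obtain ⟨w, hw, hw'⟩ := exists_zero_of_pl (h := fun y => primal g x - g (pt x y))
    (G := fun y => - grad₂ g (pt x y)) hL hc hcμ
    (continuous_const.sub (hg.continuous.comp hpt))
    (fun y => sub_nonneg.2 (le_primal hne x y))
    (fun w u => by
      have := hg.quadratic_le_snd x w u
      rw [inner_neg_left]
      linarith)
    (fun w => by rw [norm_neg]; exact hpl x w) y
  exact ⟨w, mem_argmaxY_of_eq_primal hne (sub_eq_zero.1 hw), hw'⟩

/-- Compare with a nearby maximizer `w`, where `∇₁g = ∇Φ`. Growth gives `‖w - y‖² ≤ (2/μ)` times the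
gap up to a limit, and PŁ bounds the gap by `‖∇₂g‖² / (2μ)`; the product gives the factor `(L/μ)²`.
-/
lemma norm_sq_gradient_primal_sub_le (hL : 0 < L) (hμ : 0 < μ) (hg : IsSmooth L g)
    (hne : ∀ x, (argmaxY g x).Nonempty) (hpl : PLInY μ g) (x : EuclideanSpace ℝ (Fin dx))
    (y : EuclideanSpace ℝ (Fin dy)) :
    ‖gradient (primal g) x - grad₁ g (pt x y)‖ ^ 2 ≤ (L / μ) ^ 2 * ‖grad₂ g (pt x y)‖ ^ 2 := by
  set D := ‖gradient (primal g) x - grad₁ g (pt x y)‖ ^ 2 with hD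
  set q := primal g x - g (pt x y) with hq
  have hq0 : 0 ≤ q := sub_nonneg.2 (le_primal hne x y)
  have hcD : ∀ c : ℝ, 0 < c → 2 * c ^ 2 < μ → c ^ 2 * D ≤ L ^ 2 * q := by
    intro c hc hcμ
    obtain ⟨w, hw, hwy⟩ := exists_mem_argmaxY_near hL hg hne hpl hc hcμ x y
    have h1 := hg.norm_grad₁_sub_le (pt x w) (pt x y)
    rw [← (hasGradientAt_primal hL hμ hg hne hpl hw).gradient, norm_pt_sub_right] at h1
    have h2 := pow_le_pow_left₀ (norm_nonneg _) h1 2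
    rw [← hD, mul_pow] at h2
    nlinarith [sq_nonneg c, sq_nonneg L]
  -- Let `c` increase to `√(μ/2)`, since growth is available only for `2c² < μ`.
  have hμD : μ / 2 * D ≤ L ^ 2 * q := by
    have hlim : Filter.Tendsto (fun c : ℝ => c ^ 2 * D) (nhdsWithin (√(μ / 2)) (Set.Iio (√(μ / 2))))
        (nhds (μ / 2 * D)) := by
      have h : Continuous fun c : ℝ => c ^ 2 * D := by fun_prop
      have h' := h.tendsto (√(μ / 2))
      rw [Real.sq_sqrt (by positivity)] at h'
      exact h'.mono_left nhdsWithin_le_nhds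
    refine le_of_tendsto hlim ?_
    have hpos : 0 < √(μ / 2) := Real.sqrt_pos.2 (by positivity)
    filter_upwards [Ioo_mem_nhdsLT hpos] with c hc
    refine hcD c hc.1 ?_
    have := (Real.lt_sqrt hc.1.le).1 hc.2
    linarith
  have hq' : 2 * μ * q ≤ ‖grad₂ g (pt x y)‖ ^ 2 := hpl x y
  rw [div_pow, div_mul_eq_mul_div, le_div_iff₀ (by positivity)]
  nlinarith [sq_nonneg L]

end Primal

/-! ### Second moments of sampling without replacement -/

section Permutations

variable {E : Type*} [NormedAddCommGroup E] [InnerProductSpace ℝ E] {n : ℕ}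

lemma sum_perm_inner_map (b : Fin n → E) (π : Equiv.Perm (Fin n)) (j k : Fin n) :
    ∑ σ : Equiv.Perm (Fin n), ⟪b (σ (π j)), b (σ (π k))⟫
      = ∑ σ : Equiv.Perm (Fin n), ⟪b (σ j), b (σ k)⟫ :=
  Fintype.sum_equiv (Equiv.mulRight π) _ _ fun _ => rfl

lemma sum_perm_norm_sq (b : Fin n → E) (j : Fin n) :
    ∑ σ : Equiv.Perm (Fin n), ‖b (σ j)‖ ^ 2
      = (Fintype.card (Equiv.Perm (Fin n)) : ℝ) * (1 / (n : ℝ) * ∑ i, ‖b i‖ ^ 2) := by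
  have hn : (n : ℝ) ≠ 0 := Nat.cast_ne_zero.2 (Fin.pos j).ne'
  have h1 : ∀ i, ∑ σ : Equiv.Perm (Fin n), ‖b (σ i)‖ ^ 2
      = ∑ σ : Equiv.Perm (Fin n), ‖b (σ j)‖ ^ 2 := fun i => by
    have h := sum_perm_inner_map b (Equiv.swap i j) j j
    simpa only [Equiv.swap_apply_right, real_inner_self_eq_norm_sq] using h
  have h2 : ∑ i, ∑ σ : Equiv.Perm (Fin n), ‖b (σ i)‖ ^ 2
      = (Fintype.card (Equiv.Perm (Fin n)) : ℝ) * ∑ i, ‖b i‖ ^ 2 := by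
    rw [Finset.sum_comm, Finset.sum_congr rfl fun σ _ => Equiv.sum_comp σ fun i => ‖b i‖ ^ 2]
    simp
  rw [Finset.sum_congr rfl fun i _ => h1 i] at h2
  simp only [Finset.sum_const, Finset.card_univ, Fintype.card_fin, nsmul_eq_mul] at h2
  field_simp
  linarith

/-- By symmetry all correlations between `j` and another position are equal. Together with the
variance at `j` they sum to zero, so each is non-positive. -/
lemma sum_perm_inner_nonpos {b : Fin n → E} (hb : ∑ i, b i = 0) {j k : Fin n} (hjk : j ≠ k) :
    ∑ σ : Equiv.Perm (Fin n), ⟪b (σ j), b (σ k)⟫ ≤ 0 := by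
  have h1 : ∀ i ∈ Finset.univ.erase j, ∑ σ : Equiv.Perm (Fin n), ⟪b (σ j), b (σ i)⟫
      = ∑ σ : Equiv.Perm (Fin n), ⟪b (σ j), b (σ k)⟫ := fun i hi => by
    have h := sum_perm_inner_map b (Equiv.swap k i) j k
    rwa [Equiv.swap_apply_left,
      Equiv.swap_apply_of_ne_of_ne hjk (Finset.ne_of_mem_erase hi).symm] at h
  have h2 : ∑ i, ∑ σ : Equiv.Perm (Fin n), ⟪b (σ j), b (σ i)⟫ = 0 := by
    rw [Finset.sum_comm]
    refine Finset.sum_eq_zero fun σ _ => ?_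
    rw [← inner_sum, Equiv.sum_comp σ b, hb, inner_zero_right]
  rw [← Finset.add_sum_erase _ _ (Finset.mem_univ j), Finset.sum_congr rfl h1,
    Finset.sum_const, nsmul_eq_mul] at h2
  have h3 : 0 ≤ ∑ σ : Equiv.Perm (Fin n), ⟪b (σ j), b (σ j)⟫ :=
    Finset.sum_nonneg fun _ _ => real_inner_self_nonneg
  have h4 : 0 < ((Finset.univ.erase j).card : ℝ) :=
    Nat.cast_pos.2 (Finset.card_pos.2 ⟨k, by simp [hjk.symm]⟩)
  by_contra! h
  nlinarith [mul_pos h4 h]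

lemma sum_perm_norm_sq_sum_le {b : Fin n → E} (hb : ∑ i, b i = 0) (P : Finset (Fin n)) :
    ∑ σ : Equiv.Perm (Fin n), ‖∑ j ∈ P, b (σ j)‖ ^ 2
      ≤ (Fintype.card (Equiv.Perm (Fin n)) : ℝ) * (P.card * (1 / (n : ℝ) * ∑ i, ‖b i‖ ^ 2)) := by
  calc ∑ σ : Equiv.Perm (Fin n), ‖∑ j ∈ P, b (σ j)‖ ^ 2
      = ∑ σ : Equiv.Perm (Fin n), ∑ j ∈ P, ∑ k ∈ P, ⟪b (σ j), b (σ k)⟫ := by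
        refine Finset.sum_congr rfl fun σ _ => ?_
        rw [← real_inner_self_eq_norm_sq, sum_inner]
        exact Finset.sum_congr rfl fun j _ => inner_sum _ _ _
    _ = ∑ j ∈ P, ∑ k ∈ P, ∑ σ : Equiv.Perm (Fin n), ⟪b (σ j), b (σ k)⟫ := by
        rw [Finset.sum_comm]
        exact Finset.sum_congr rfl fun j _ => Finset.sum_comm
    _ ≤ ∑ j ∈ P, (Fintype.card (Equiv.Perm (Fin n)) : ℝ) * (1 / (n : ℝ) * ∑ i, ‖b i‖ ^ 2) := by
        refine Finset.sum_le_sum fun j hj => ?_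
        rw [← Finset.add_sum_erase _ _ hj]
        simp only [real_inner_self_eq_norm_sq]
        rw [sum_perm_norm_sq]
        refine add_le_of_nonpos_right (Finset.sum_nonpos fun k hk => ?_)
        exact sum_perm_inner_nonpos hb (Finset.ne_of_mem_erase hk).symm
    _ = _ := by
        rw [Finset.sum_const, nsmul_eq_mul]; ring

/-- Second moment of a partial sum sampled without replacement. -/
lemma sum_perm_norm_sq_partial_le (a : Fin n → E) (m : E) (hm : m = (1 / (n : ℝ)) • ∑ i, a i)
    {s : ℝ} (hs : 1 / (n : ℝ) * ∑ i, ‖a i - m‖ ^ 2 ≤ s) (P : Finset (Fin n)) :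
    ∑ σ : Equiv.Perm (Fin n), ‖∑ j ∈ P, a (σ j)‖ ^ 2
      ≤ (Fintype.card (Equiv.Perm (Fin n)) : ℝ) * (2 * (n : ℝ) ^ 2 * ‖m‖ ^ 2 + 2 * n * s) := by
  have hcard : (P.card : ℝ) ≤ n := by
    exact_mod_cast (Finset.card_le_univ P).trans_eq (Fintype.card_fin n)
  have h0 : ∑ i, (a i - m) = 0 := by
    rcases Nat.eq_zero_or_pos n with rfl | hn
    · simp
    · have hn' : (n : ℝ) ≠ 0 := Nat.cast_ne_zero.2 hn.ne'
      rw [Finset.sum_sub_distrib, Finset.sum_const, Finset.card_univ, Fintype.card_fin, hm,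
        ← Nat.cast_smul_eq_nsmul ℝ, smul_smul, mul_one_div_cancel hn', one_smul, sub_self]
  have h1 := sum_perm_norm_sq_sum_le h0 P
  have hs0 : 0 ≤ 1 / (n : ℝ) * ∑ i, ‖a i - m‖ ^ 2 := by positivity
  -- Splitting off the mean costs a factor 2; only the centred part needs the correlation bound.
  have h2 : ∀ σ : Equiv.Perm (Fin n), ‖∑ j ∈ P, a (σ j)‖ ^ 2
      ≤ 2 * (n : ℝ) ^ 2 * ‖m‖ ^ 2 + 2 * ‖∑ j ∈ P, (a (σ j) - m)‖ ^ 2 := fun σ => by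
    have e : ∑ j ∈ P, a (σ j) = (P.card : ℝ) • m + ∑ j ∈ P, (a (σ j) - m) := by
      rw [Finset.sum_sub_distrib, Finset.sum_const, Nat.cast_smul_eq_nsmul, add_sub_cancel]
    have h3 : ‖∑ j ∈ P, a (σ j)‖ ≤ n * ‖m‖ + ‖∑ j ∈ P, (a (σ j) - m)‖ := by
      rw [e]
      refine (norm_add_le _ _).trans ?_
      rw [norm_smul, Real.norm_of_nonneg (Nat.cast_nonneg _)]
      gcongr
    have h4 := pow_le_pow_left₀ (norm_nonneg _) h3 2
    nlinarith [sq_nonneg (n * ‖m‖ - ‖∑ j ∈ P, (a (σ j) - m)‖)]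
  refine (Finset.sum_le_sum fun σ _ => h2 σ).trans ?_
  rw [Finset.sum_add_distrib, Finset.sum_const, Finset.card_univ, nsmul_eq_mul, ← Finset.mul_sum,
    mul_add]
  have h5 : (P.card : ℝ) * (1 / (n : ℝ) * ∑ i, ‖a i - m‖ ^ 2) ≤ n * s := by gcongr
  have h6 := mul_le_mul_of_nonneg_left h5 (Nat.cast_nonneg (α := ℝ)
    (Fintype.card (Equiv.Perm (Fin n))))
  linarith

end Permutations

/-! ### Drift of incremental sequences and scalar inner-product bounds -/

lemma norm_sq_sum_le_of_norm_le {E : Type*} [NormedAddCommGroup E] {n : ℕ}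
    {e : Fin n → E} {δ : Fin n → ℝ} {L D : ℝ}
    (he : ∀ i, ‖e i‖ ≤ L * δ i) (hD : ∑ i, δ i ^ 2 ≤ D) (P : Finset (Fin n)) :
    ‖∑ j ∈ P, e j‖ ^ 2 ≤ n * L ^ 2 * D := by
  have hcard : (P.card : ℝ) ≤ n := by
    exact_mod_cast (Finset.card_le_univ P).trans_eq (Fintype.card_fin n)
  have hD0 : 0 ≤ D := (Finset.sum_nonneg fun i _ => sq_nonneg (δ i)).trans hD
  calc ‖∑ j ∈ P, e j‖ ^ 2 ≤ (∑ j ∈ P, ‖e j‖) ^ 2 := by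
        gcongr; exact norm_sum_le _ _
    _ ≤ P.card * ∑ j ∈ P, ‖e j‖ ^ 2 := sq_sum_le_card_mul_sum_sq
    _ ≤ n * ∑ j, ‖e j‖ ^ 2 := by
        gcongr
        exact Finset.subset_univ P
    _ ≤ n * ∑ j, L ^ 2 * δ j ^ 2 := by
        gcongr with j
        rw [← mul_pow]
        exact pow_le_pow_left₀ (norm_nonneg _) (he j) 2
    _ ≤ n * L ^ 2 * D := by
        rw [← Finset.mul_sum, mul_assoc]; gcongr

section Sequences

variable {E : Type*} [NormedAddCommGroup E] [InnerProductSpace ℝ E] {n : ℕ}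

lemma eq_add_smul_sum_filter {a : Fin (n + 1) → E} {v : Fin n → E} {c : ℝ}
    (h : ∀ i : Fin n, a i.succ = a i.castSucc + c • v i) (i : Fin (n + 1)) :
    a i = a 0 + c • ∑ j : Fin n with j.castSucc < i, v j := by
  induction i using Fin.induction with
  | zero => simp
  | succ i ih =>
    have e : (Finset.univ.filter fun j : Fin n => j.castSucc < i.succ)
        = insert i (Finset.univ.filter fun j : Fin n => j.castSucc < i.castSucc) := by
      ext j
      simp only [Finset.mem_filter, Finset.mem_univ, true_and, Finset.mem_insert,
        Fin.castSucc_lt_succ_iff, Fin.castSucc_lt_castSucc_iff]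
      exact le_iff_eq_or_lt
    rw [h, ih, e, Finset.sum_insert (by simp), smul_add]
    abel

lemma last_eq_add_smul_sum {a : Fin (n + 1) → E} {v : Fin n → E} {c : ℝ}
    (h : ∀ i : Fin n, a i.succ = a i.castSucc + c • v i) :
    a (Fin.last n) = a 0 + c • ∑ j, v j := by
  rw [eq_add_smul_sum_filter h, Finset.filter_true_of_mem fun j _ => Fin.castSucc_lt_last j]

/-- Drift of a sequence with increments `c • v i` from its start, when the increments are compared
to reference increments `c • v₀ i`. -/
lemma sum_norm_sq_sub_le {a : Fin (n + 1) → E} {v v₀ : Fin n → E} {δ : Fin n → ℝ} {c L D : ℝ}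
    (h : ∀ i : Fin n, a i.succ = a i.castSucc + c • v i) (hv : ∀ i, ‖v i - v₀ i‖ ≤ L * δ i)
    (hD : ∑ i, δ i ^ 2 ≤ D) :
    ∑ i : Fin n, ‖a i.succ - a 0‖ ^ 2
      ≤ 2 * c ^ 2 * ∑ i : Fin n, ‖∑ j : Fin n with j.castSucc < i.succ, v₀ j‖ ^ 2
        + 2 * c ^ 2 * (n : ℝ) ^ 2 * L ^ 2 * D := by
  have h1 : ∀ i : Fin n, ‖a i.succ - a 0‖ ^ 2
      ≤ 2 * c ^ 2 * ‖∑ j : Fin n with j.castSucc < i.succ, v₀ j‖ ^ 2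
        + 2 * c ^ 2 * (n * L ^ 2 * D) := fun i => by
    set P := Finset.univ.filter fun j : Fin n => j.castSucc < i.succ with hP
    have e : a i.succ - a 0 = c • (∑ j ∈ P, v₀ j + ∑ j ∈ P, (v j - v₀ j)) := by
      rw [eq_add_smul_sum_filter h i.succ, add_sub_cancel_left, Finset.sum_sub_distrib,
        add_sub_cancel]
    have h2 := norm_sq_sum_le_of_norm_le hv hD P
    have h3 : ‖∑ j ∈ P, v₀ j + ∑ j ∈ P, (v j - v₀ j)‖ ^ 2
        ≤ 2 * ‖∑ j ∈ P, v₀ j‖ ^ 2 + 2 * ‖∑ j ∈ P, (v j - v₀ j)‖ ^ 2 := by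
      have h4 := pow_le_pow_left₀ (norm_nonneg _)
        (norm_add_le (∑ j ∈ P, v₀ j) (∑ j ∈ P, (v j - v₀ j))) 2
      nlinarith [sq_nonneg (‖∑ j ∈ P, v₀ j‖ - ‖∑ j ∈ P, (v j - v₀ j)‖)]
    rw [e, norm_smul, mul_pow, Real.norm_eq_abs, sq_abs]
    nlinarith [sq_nonneg c]
  refine (Finset.sum_le_sum fun i _ => h1 i).trans (le_of_eq ?_)
  rw [Finset.sum_add_distrib, ← Finset.mul_sum, Finset.sum_const, Finset.card_univ,
    Fintype.card_fin, nsmul_eq_mul]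
  ring

/-- The total displacement is `n c` times the mean reference increment, up to the drift. -/
lemma exists_last_eq {a : Fin (n + 1) → E} {v v₀ : Fin n → E} {δ : Fin n → ℝ} {c L D : ℝ}
    (hn : 0 < n) (h : ∀ i : Fin n, a i.succ = a i.castSucc + c • v i)
    (hv : ∀ i, ‖v i - v₀ i‖ ≤ L * δ i) (hD : ∑ i, δ i ^ 2 ≤ D) :
    ∃ e : E, a (Fin.last n) - a 0 = (c * n) • ((1 / (n : ℝ)) • ∑ i, v₀ i + e)
      ∧ ‖e‖ ^ 2 ≤ L ^ 2 / n * D := by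
  have hn' : (n : ℝ) ≠ 0 := Nat.cast_ne_zero.2 hn.ne'
  refine ⟨(1 / (n : ℝ)) • ∑ i, (v i - v₀ i), ?_, ?_⟩
  · rw [last_eq_add_smul_sum h, add_sub_cancel_left, ← smul_add, Finset.sum_sub_distrib,
      add_sub_cancel, smul_smul, mul_assoc, mul_one_div_cancel hn', mul_one]
  · rw [norm_smul, mul_pow, Real.norm_of_nonneg (by positivity)]
    have h1 := norm_sq_sum_le_of_norm_le hv hD Finset.univ
    calc (1 / (n : ℝ)) ^ 2 * ‖∑ i, (v i - v₀ i)‖ ^ 2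
        ≤ (1 / (n : ℝ)) ^ 2 * (n * L ^ 2 * D) := by gcongr
      _ = L ^ 2 / n * D := by field_simp

/-- The weights `5` and `1` are those of `Φ` and `-f` in the potential. The difference of the two
sides is `5/4 ‖(p - g) + 2e‖² + 1/4 ‖3p - g‖²`. -/
lemma inner_primal_step_le (p g e : E) :
    -5 * ⟪p, g + e⟫ + ⟪g, g + e⟫
      ≤ -‖p‖ ^ 2 - 2 * ‖g + e‖ ^ 2 + 9 / 2 * ‖p - g‖ ^ 2 + 7 * ‖e‖ ^ 2 := by
  have h1 : 0 ≤ ‖(p - g) + (2 : ℝ) • e‖ ^ 2 := sq_nonneg _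
  have h2 : 0 ≤ ‖(3 : ℝ) • p - g‖ ^ 2 := sq_nonneg _
  rw [norm_add_sq_real, norm_sub_sq_real, inner_sub_left, norm_smul, mul_pow,
    real_inner_smul_right, real_inner_smul_right] at h1
  rw [norm_sub_sq_real, norm_smul, mul_pow, real_inner_smul_left] at h2
  norm_num at h1 h2
  rw [norm_add_sq_real, norm_sub_sq_real, inner_add_right, inner_add_right,
    real_inner_self_eq_norm_sq]
  linarith

lemma inner_dual_step_le (g e : E) :
    -⟪g, g + e⟫ = -(1 / 2) * ‖g‖ ^ 2 - 1 / 2 * ‖g + e‖ ^ 2 + 1 / 2 * ‖e‖ ^ 2 := by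
  rw [norm_add_sq_real, inner_add_right, real_inner_self_eq_norm_sq]
  ring

end Sequences

/-! ### One epoch as an inexact full-gradient step -/

section Epoch

variable {dx dy n : ℕ}

/-- The point at which the `y`-update that leads from `z` to `step v α β g z` evaluates `∇₂ g`. -/
noncomputable def dualEvalPoint (v : Variant) (α β : ℝ) (g : Z dx dy → ℝ) (z : Z dx dy) : Z dx dy :=
  match v with
  | Variant.sim => z
  | Variant.alt => pt (step Variant.alt α β g z).fst z.snd

lemma step_fst (v : Variant) (α β : ℝ) (g : Z dx dy → ℝ) (z : Z dx dy) :
    (step v α β g z).fst = z.fst + (-α) • grad₁ g z := by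
  rw [neg_smul, ← sub_eq_add_neg]
  cases v <;> rfl

lemma step_snd (v : Variant) (α β : ℝ) (g : Z dx dy → ℝ) (z : Z dx dy) :
    (step v α β g z).snd = z.snd + β • grad₂ g (dualEvalPoint v α β g z) := by
  cases v <;> rfl

lemma innerIterate_succ (v : Variant) (α β : ℝ) (f : Fin n → Z dx dy → ℝ)
    (τ : Equiv.Perm (Fin n)) (z : Z dx dy) (i : Fin n) :
    innerIterate v α β f τ z i.succ
      = step v α β (f (τ i)) (innerIterate v α β f τ z i.castSucc) := rfl

lemma sum_castSucc_le_sum_succ {h : Fin (n + 1) → ℝ} (h0 : h 0 = 0) (hlast : 0 ≤ h (Fin.last n)) :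
    ∑ i : Fin n, h i.castSucc ≤ ∑ i : Fin n, h i.succ := by
  have h1 := Fin.sum_univ_castSucc h
  have h2 := Fin.sum_univ_succ h
  linarith

/-- This lets both variants share one drift estimate: the alternating point takes `x` from the next
iterate and `y` from the current one, and shifting the `y` index is free because the first distance
is zero. -/
lemma sum_dualEvalPoint_le (v : Variant) (α β : ℝ) (f : Fin n → Z dx dy → ℝ)
    (τ : Equiv.Perm (Fin n)) (z : Z dx dy) :
    ∑ i : Fin n, ‖dualEvalPoint v α β (f (τ i)) (innerIterate v α β f τ z i.castSucc) - z‖ ^ 2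
      ≤ ∑ i : Fin n, ‖innerIterate v α β f τ z i.succ - z‖ ^ 2 := by
  set w := innerIterate v α β f τ z with hw
  have hw0 : w 0 = z := rfl
  cases v with
  | sim =>
    exact sum_castSucc_le_sum_succ (h := fun i => ‖w i - z‖ ^ 2) (by simp [hw0]) (by positivity)
  | alt =>
    have h1 : ∀ i : Fin n,
        ‖dualEvalPoint Variant.alt α β (f (τ i)) (w i.castSucc) - z‖ ^ 2
          = ‖(w i.succ).fst - z.fst‖ ^ 2 + ‖(w i.castSucc).snd - z.snd‖ ^ 2 :=
      fun i => norm_sq_eq_blocks _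
    have h2 : ∀ i : Fin n, ‖w i.succ - z‖ ^ 2
        = ‖(w i.succ).fst - z.fst‖ ^ 2 + ‖(w i.succ).snd - z.snd‖ ^ 2 :=
      fun i => norm_sq_eq_blocks _
    rw [Finset.sum_congr rfl fun i _ => h1 i, Finset.sum_congr rfl fun i _ => h2 i,
      Finset.sum_add_distrib, Finset.sum_add_distrib]
    have h3 := sum_castSucc_le_sum_succ (h := fun i => ‖(w i).snd - z.snd‖ ^ 2)
      (by simp [hw0]) (by positivity)
    linarith

/-- Sum of squared norms of the partial sums of `∇₁ f_{τ j}` at a fixed point. -/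
noncomputable def partialSums₁ (f : Fin n → Z dx dy → ℝ) (τ : Equiv.Perm (Fin n))
    (z : Z dx dy) : ℝ :=
  ∑ i : Fin n, ‖∑ j : Fin n with j.castSucc < i.succ, grad₁ (f (τ j)) z‖ ^ 2

/-- Sum of squared norms of the partial sums of `∇₂ f_{τ j}` at a fixed point. -/
noncomputable def partialSums₂ (f : Fin n → Z dx dy → ℝ) (τ : Equiv.Perm (Fin n))
    (z : Z dx dy) : ℝ :=
  ∑ i : Fin n, ‖∑ j : Fin n with j.castSucc < i.succ, grad₂ (f (τ j)) z‖ ^ 2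

/-- One epoch is one step along the full gradients with stepsizes `n α`, `n β`, up to errors
controlled by the partial sums. -/
lemma exists_epoch_eq {L α β : ℝ} (hn : 0 < n) (v : Variant) {f : Fin n → Z dx dy → ℝ}
    (hf : ∀ i, IsSmooth L (f i)) (hα : 14 * |α| ≤ β)
    (hβ : (6 * L * (β * n)) ^ 2 ≤ 1)
    (τ : Equiv.Perm (Fin n)) (z : Z dx dy) :
    ∃ e₁ e₂,
      (innerIterate v α β f τ z (Fin.last n)).fst - z.fst
        = -((α * n) • (grad₁ (objective f) z + e₁)) ∧
      (innerIterate v α β f τ z (Fin.last n)).snd - z.snd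
        = (β * n) • (grad₂ (objective f) z + e₂) ∧
      ‖e₁‖ ^ 2 ≤ 17 / 8 * (L ^ 2 / n) * (α ^ 2 * partialSums₁ f τ z + β ^ 2 * partialSums₂ f τ z) ∧
      ‖e₂‖ ^ 2 ≤ 17 / 8 * (L ^ 2 / n) *
        (α ^ 2 * partialSums₁ f τ z + β ^ 2 * partialSums₂ f τ z) := by
  set w := innerIterate v α β f τ z with hw
  have hw0 : w 0 = z := rfl
  set W := ∑ i : Fin n, ‖w i.succ - z‖ ^ 2 with hW
  have hW0 : 0 ≤ W := by positivity
  set u : Fin n → Z dx dy := fun i => dualEvalPoint v α β (f (τ i)) (w i.castSucc) with hu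
  have hx : ∀ i : Fin n, (w i.succ).fst
      = (w i.castSucc).fst + (-α) • grad₁ (f (τ i)) (w i.castSucc) := fun i => step_fst _ _ _ _ _
  have hy : ∀ i : Fin n, (w i.succ).snd
      = (w i.castSucc).snd + β • grad₂ (f (τ i)) (u i) := fun i => step_snd _ _ _ _ _
  have hvx : ∀ i : Fin n, ‖grad₁ (f (τ i)) (w i.castSucc) - grad₁ (f (τ i)) z‖
      ≤ L * ‖w i.castSucc - z‖ := fun i => (hf _).norm_grad₁_sub_le _ _
  have hvy : ∀ i : Fin n, ‖grad₂ (f (τ i)) (u i) - grad₂ (f (τ i)) z‖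
      ≤ L * ‖u i - z‖ := fun i => (hf _).norm_grad₂_sub_le _ _
  have hDx : ∑ i : Fin n, ‖w i.castSucc - z‖ ^ 2 ≤ W :=
    sum_castSucc_le_sum_succ (h := fun i => ‖w i - z‖ ^ 2) (by simp [hw0]) (by positivity)
  have hDy : ∑ i : Fin n, ‖u i - z‖ ^ 2 ≤ W := sum_dualEvalPoint_le v α β f τ z
  have hX := sum_norm_sq_sub_le (a := fun i => (w i).fst) hx hvx hDx
  have hY := sum_norm_sq_sub_le (a := fun i => (w i).snd) hy hvy hDy
  have hWXY : W = ∑ i : Fin n, ‖(w i.succ).fst - (w 0).fst‖ ^ 2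
      + ∑ i : Fin n, ‖(w i.succ).snd - (w 0).snd‖ ^ 2 := by
    rw [hW, ← Finset.sum_add_distrib]
    exact Finset.sum_congr rfl fun i _ => norm_sq_eq_blocks _
  have hα2 : 196 * α ^ 2 ≤ β ^ 2 := by
    have h := pow_le_pow_left₀ (by positivity) hα 2
    rw [mul_pow, sq_abs] at h
    linarith
  -- The drift `W` bounds itself with coefficient `2(α² + β²)n²L² ≤ 1/17`, and `2 / (1 - 1/17) =
  -- 17/8`.
  have hWle : W ≤ 17 / 8 * (α ^ 2 * partialSums₁ f τ z + β ^ 2 * partialSums₂ f τ z) := by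
    have h1 : W ≤ 2 * (α ^ 2 * partialSums₁ f τ z + β ^ 2 * partialSums₂ f τ z)
        + 2 * (α ^ 2 + β ^ 2) * ((n : ℝ) ^ 2 * L ^ 2 * W) := by
      simp only [partialSums₁, partialSums₂]
      rw [neg_sq] at hX
      linarith
    have h2 : 0 ≤ (n : ℝ) ^ 2 * L ^ 2 * W := by positivity
    have h3 : β ^ 2 * ((n : ℝ) ^ 2 * L ^ 2 * W) ≤ 1 / 36 * W := by
      have := mul_le_mul_of_nonneg_right hβ hW0
      nlinarith
    nlinarith [mul_le_mul_of_nonneg_right hα2 h2]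
  obtain ⟨e₁, he₁, he₁'⟩ := exists_last_eq (a := fun i => (w i).fst) hn hx hvx hDx
  obtain ⟨e₂, he₂, he₂'⟩ := exists_last_eq (a := fun i => (w i).snd) hn hy hvy hDy
  have hd := fun i => (hf i).1
  rw [Equiv.sum_comp τ fun i => grad₁ (f i) z, ← grad₁_objective hd] at he₁
  rw [Equiv.sum_comp τ fun i => grad₂ (f i) z, ← grad₂_objective hd] at he₂
  have hLn : 0 ≤ L ^ 2 / n := by positivity
  refine ⟨e₁, e₂, ?_, he₂, ?_, ?_⟩
  · rw [neg_mul, neg_smul] at he₁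
    exact he₁
  · nlinarith [mul_le_mul_of_nonneg_left hWle hLn]
  · nlinarith [mul_le_mul_of_nonneg_left hWle hLn]

end Epoch

/-! ### Expected descent of the potential over one epoch -/

section EpochDescent

variable {dx dy n : ℕ}

/-- Descent of the potential along `z ↦ (x - a (∇₁ g + e₁); y + b (∇₂ g + e₂))`. -/
lemma potential_le_of_inexact_step {g : Z dx dy → ℝ} {L μ a b r R : ℝ} (hL : 0 < L) (hμ : 0 < μ)
    (hμL : μ ≤ L) (hg : IsSmooth L g) (hne : ∀ x, (argmaxY g x).Nonempty) (hpl : PLInY μ g)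
    (ha : 0 ≤ a) (hab : r * a = b) (hr : 14 * (L / μ) ^ 2 ≤ r) (hb : 6 * L * b ≤ 1)
    {z z' : Z dx dy} {e₁ : EuclideanSpace ℝ (Fin dx)} {e₂ : EuclideanSpace ℝ (Fin dy)}
    (hx : z'.fst - z.fst = -(a • (grad₁ g z + e₁))) (hy : z'.snd - z.snd = b • (grad₂ g z + e₂))
    (he₁ : ‖e₁‖ ^ 2 ≤ R) (he₂ : ‖e₂‖ ^ 2 ≤ R) :
    potential 4 g z' ≤ potential 4 g z - a * ‖gradient (primal g) z.fst‖ ^ 2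
      - 5 / 28 * b * ‖grad₂ g z‖ ^ 2 + b * R := by
  have hκ : 1 ≤ L / μ := (one_le_div hμ).2 hμL
  set κ := L / μ with hκd
  have hLμ : L ^ 2 / (2 * μ) = L * κ / 2 := by rw [hκd]; field_simp
  set p := gradient (primal g) z.fst with hp
  set g₁ := grad₁ g z with hg₁
  set g₂ := grad₂ g z with hg₂
  have hΦ := primal_le_quadratic hL hμ hg hne hpl z.fst z'.fst
  have hf := hg.quadratic_le z z'
  rw [inner_gradient_eq_blocks, norm_sq_eq_blocks (z' - z), WithLp.sub_fst, WithLp.sub_snd,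
    hx, hy] at hf
  rw [hx, hLμ] at hΦ
  rw [← hp] at hΦ
  rw [← hg₁, ← hg₂] at hf
  rw [norm_neg, norm_smul, mul_pow, Real.norm_eq_abs, sq_abs, inner_neg_right,
    real_inner_smul_right] at hΦ hf
  rw [norm_smul, mul_pow, Real.norm_eq_abs, sq_abs, real_inner_smul_right] at hf
  have hi := mul_le_mul_of_nonneg_left (inner_primal_step_le p g₁ e₁) ha
  have hii := inner_dual_step_le g₂ e₂
  have hd : ‖p - g₁‖ ^ 2 ≤ κ ^ 2 * ‖g₂‖ ^ 2 :=
    norm_sq_gradient_primal_sub_le hL hμ hg hne hpl z.fst z.snd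
  have hκ2 : κ ≤ κ ^ 2 := by nlinarith
  have hakb : 14 * (a * κ ^ 2) ≤ b := by nlinarith
  have hb0 : 0 ≤ b := le_trans (by positivity) hakb
  have hak : 0 ≤ a * κ ^ 2 := by positivity
  have hak1 : a * κ ≤ a * κ ^ 2 := mul_le_mul_of_nonneg_left hκ2 ha
  have hak2 : a ≤ a * κ := le_mul_of_one_le_right ha hκ
  -- The mismatch uses `9/28` of the available `1/2 · b‖g₂‖²`, which leaves the `5/28` of the
  -- conclusion.
  have h1 : a * (9 / 2 * ‖p - g₁‖ ^ 2) ≤ 9 / 28 * b * ‖g₂‖ ^ 2 := by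
    have := mul_le_mul_of_nonneg_left hd ha
    have := mul_le_mul_of_nonneg_right hakb (sq_nonneg ‖g₂‖)
    linarith
  have hR : 0 ≤ R := (sq_nonneg _).trans he₁
  have h2 : a * (7 * ‖e₁‖ ^ 2) ≤ b / 2 * R := by
    have := mul_le_mul_of_nonneg_left he₁ ha
    have := mul_le_mul_of_nonneg_right (show 14 * a ≤ b by linarith) hR
    linarith
  have h3 : b * (1 / 2 * ‖e₂‖ ^ 2) ≤ b / 2 * R := by
    have := mul_le_mul_of_nonneg_left he₂ hb0
    linarith
  have hLb : L * b ≤ 1 / 6 := by linarith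
  have hLak : L * (a * κ) ≤ 1 / 84 := by
    have := mul_le_mul_of_nonneg_left (show 14 * (a * κ) ≤ b by linarith) hL.le
    linarith
  have hLa : L * a ≤ 1 / 84 := (mul_le_mul_of_nonneg_left hak2 hL.le).trans hLak
  -- All curvature terms in `x`, from `Φ` with weight 5 and from `f`, are absorbed by `-2a‖g₁ +
  -- e₁‖²`.
  have h4 : (5 * (L / 2 + L * κ / 2) + L / 2) * (a ^ 2 * ‖g₁ + e₁‖ ^ 2)
      ≤ a * (2 * ‖g₁ + e₁‖ ^ 2) := by
    have h : (5 * (L / 2 + L * κ / 2) + L / 2) * a ≤ 2 := by linarith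
    have := mul_le_mul_of_nonneg_right h (mul_nonneg ha (sq_nonneg ‖g₁ + e₁‖))
    linarith
  have h5 : L / 2 * (b ^ 2 * ‖g₂ + e₂‖ ^ 2) ≤ b * (1 / 2 * ‖g₂ + e₂‖ ^ 2) := by
    have := mul_le_mul_of_nonneg_right (show L / 2 * b ≤ 1 / 2 by linarith)
      (mul_nonneg hb0 (sq_nonneg ‖g₂ + e₂‖))
    linarith
  have hii' : b * ⟪g₂, g₂ + e₂⟫
      = b * (1 / 2 * ‖g₂‖ ^ 2) + b * (1 / 2 * ‖g₂ + e₂‖ ^ 2) - b * (1 / 2 * ‖e₂‖ ^ 2) := by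
    linear_combination (-b) * hii
  unfold potential
  linarith

lemma sum_partialSums₁_le {A B : ℝ} {f : Fin n → Z dx dy → ℝ}
    (hd : ∀ i, Differentiable ℝ (f i)) (hv : BoundedVariance A B f) (z : Z dx dy) :
    ∑ τ, partialSums₁ f τ z ≤ (Fintype.card (Equiv.Perm (Fin n)) : ℝ)
      * (2 * (n : ℝ) ^ 2 * ((n + A) * ‖grad₁ (objective f) z‖ ^ 2 + B)) := by
  unfold partialSums₁
  rw [Finset.sum_comm]
  refine (Finset.sum_le_sum fun i _ => sum_perm_norm_sq_partial_le (fun j => grad₁ (f j) z) _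
    (grad₁_objective hd z) (hv z).1 _).trans (le_of_eq ?_)
  rw [Finset.sum_const, Finset.card_univ, Fintype.card_fin, nsmul_eq_mul]
  ring

lemma sum_partialSums₂_le {A B : ℝ} {f : Fin n → Z dx dy → ℝ}
    (hd : ∀ i, Differentiable ℝ (f i)) (hv : BoundedVariance A B f) (z : Z dx dy) :
    ∑ τ, partialSums₂ f τ z ≤ (Fintype.card (Equiv.Perm (Fin n)) : ℝ)
      * (2 * (n : ℝ) ^ 2 * ((n + A) * ‖grad₂ (objective f) z‖ ^ 2 + B)) := by
  unfold partialSums₂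
  rw [Finset.sum_comm]
  refine (Finset.sum_le_sum fun i _ => sum_perm_norm_sq_partial_le (fun j => grad₂ (f j) z) _
    (grad₂_objective hd z) (hv z).2 _).trans (le_of_eq ?_)
  rw [Finset.sum_const, Finset.card_univ, Fintype.card_fin, nsmul_eq_mul]
  ring

lemma norm_sq_grad₁_le {g : Z dx dy → ℝ} {L μ : ℝ} (hL : 0 < L) (hμ : 0 < μ)
    (hg : IsSmooth L g) (hne : ∀ x, (argmaxY g x).Nonempty) (hpl : PLInY μ g) (z : Z dx dy) :
    ‖grad₁ g z‖ ^ 2 ≤ 2 * ‖gradient (primal g) z.fst‖ ^ 2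
      + 2 * ((L / μ) ^ 2 * ‖grad₂ g z‖ ^ 2) := by
  have h1 := norm_sq_gradient_primal_sub_le hL hμ hg hne hpl z.fst z.snd
  have h2 : ‖grad₁ g z‖ ≤ ‖gradient (primal g) z.fst‖
      + ‖gradient (primal g) z.fst - grad₁ g (pt z.fst z.snd)‖ := by
    rw [pt_fst_snd, norm_sub_rev]
    exact norm_le_norm_add_norm_sub' _ _
  have h3 := pow_le_pow_left₀ (norm_nonneg _) h2 2
  rw [pt_fst_snd] at h1 h3
  nlinarith [sq_nonneg (‖gradient (primal g) z.fst‖ - ‖gradient (primal g) z.fst - grad₁ g z‖)]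

/-- The part of the sampling error proportional to the gradients is absorbed by the descent. -/
lemma sampling_error_le {n L A B α β κ p q₁ q₂ : ℝ} (hn' : 0 < n) (hA : 0 ≤ A) (hB : 0 ≤ B)
    (hα : 0 ≤ α) (h14 : 14 * α ≤ β) (hακ : 14 * (α * κ ^ 2) ≤ β)
    (hβ : 36 * L ^ 2 * β ^ 2 * (n * (n + A)) ≤ 1) (hp0 : 0 ≤ p) (hq₁0 : 0 ≤ q₁) (hq₂0 : 0 ≤ q₂)
    (hq₁le : q₁ ≤ 2 * p + 2 * (κ ^ 2 * q₂)) :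
    β * n * (17 / 8 * (L ^ 2 / n)) * (α ^ 2 * (2 * n ^ 2 * ((n + A) * q₁ + B))
        + β ^ 2 * (2 * n ^ 2 * ((n + A) * q₂ + B)))
      ≤ α * n / 2 * p + 5 / 28 * (β * n) * q₂ + 5 * L ^ 2 * n ^ 2 * β ^ 3 * B := by
  have hβ0 : 0 ≤ β := by linarith
  have hα2 : 196 * α ^ 2 ≤ β ^ 2 := by nlinarith
  set s := 36 * L ^ 2 * (n * (n + A)) with hs
  have hs0 : 0 ≤ s := by positivity
  have hsβ : s * β ^ 2 ≤ 1 := by rw [hs]; linarith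
  have hsα : s * α ^ 2 * (β * q₁) ≤ 1 / 7 * α * p + 1 / 98 * β * q₂ := by
    have h1 : s * α ^ 2 * β ≤ 1 / 14 * α := by
      calc s * α ^ 2 * β = s * (α * β) * α := by ring
        _ ≤ 1 / 14 * α := by
          refine mul_le_mul_of_nonneg_right ?_ hα
          have := mul_le_mul_of_nonneg_left h14 (mul_nonneg hs0 hβ0)
          linarith
    have h2 := mul_le_mul h1 hq₁le hq₁0 (by positivity)
    have h3 := mul_le_mul_of_nonneg_right hακ hq₂0
    linarith
  -- `17/144 = (17/4)/36` comes from the 36 inside `s`. The slack is enough since `17/144 · (1 +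
  -- 1/98) < 5/28` and `17/4 · (1 + 1/196) < 5`.
  have e : β * n * (17 / 8 * (L ^ 2 / n)) * (α ^ 2 * (2 * n ^ 2 * ((n + A) * q₁ + B))
        + β ^ 2 * (2 * n ^ 2 * ((n + A) * q₂ + B)))
      = 17 / 144 * n * (s * α ^ 2 * (β * q₁)) + 17 / 144 * n * (s * β ^ 2 * (β * q₂))
        + 17 / 4 * (α ^ 2 + β ^ 2) * (L ^ 2 * n ^ 2 * β * B) := by
    rw [hs]; field_simp; ring
  rw [e]
  have h1 := mul_le_mul_of_nonneg_left hsα hn'.le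
  have h2 := mul_le_mul_of_nonneg_left
    (mul_le_mul_of_nonneg_right hsβ (mul_nonneg hβ0 hq₂0)) hn'.le
  have h3 := mul_le_mul_of_nonneg_right hα2
    (show 0 ≤ L ^ 2 * n ^ 2 * β * B by positivity)
  have h4 : 0 ≤ L ^ 2 * n ^ 2 * β ^ 3 * B := by positivity
  have h5 : 0 ≤ n * (α * p) := by positivity
  have h6 : 0 ≤ n * (β * q₂) := by positivity
  linarith

/-- Expected descent of the potential over one epoch. -/
lemma sum_potential_epoch_le {L A B μ r α β : ℝ} {f : Fin n → Z dx dy → ℝ} (hn : 0 < n)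
    (hL : 0 < L) (hA : 0 ≤ A) (hB : 0 ≤ B) (hμ : 0 < μ) (hμL : μ ≤ L)
    (hf : ∀ i, IsSmooth L (f i)) (hv : BoundedVariance A B f)
    (hne : ∀ x, (argmaxY (objective f) x).Nonempty) (hpl : PLInY μ (objective f))
    (hr : 14 * (L / μ) ^ 2 ≤ r) (hα : 0 ≤ α) (hαβ : r * α = β)
    (hβ : 36 * L ^ 2 * β ^ 2 * (n * (n + A)) ≤ 1) (v : Variant) (z : Z dx dy) :
    ∑ τ, potential 4 (objective f) (innerIterate v α β f τ z (Fin.last n))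
      ≤ (Fintype.card (Equiv.Perm (Fin n)) : ℝ) * (potential 4 (objective f) z
        - α * n / 2 * ‖gradient (primal (objective f)) z.fst‖ ^ 2
        + 5 * L ^ 2 * (n : ℝ) ^ 2 * β ^ 3 * B) := by
  have hn' : (0 : ℝ) < n := Nat.cast_pos.2 hn
  have hκ : 1 ≤ L / μ := (one_le_div hμ).2 hμL
  set κ := L / μ with hκd
  have hr14 : 14 ≤ r := by nlinarith
  have h14 : 14 * α ≤ β := by nlinarith
  have hβ0 : 0 ≤ β := by linarith
  have hLβ : (6 * L * (β * n)) ^ 2 ≤ 1 := by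
    refine le_trans ?_ hβ
    have : 0 ≤ 36 * L ^ 2 * β ^ 2 * (n * A) := by positivity
    nlinarith
  have hg := isSmooth_objective hn hf
  set g := objective f with hgd
  set N : ℝ := (Fintype.card (Equiv.Perm (Fin n)) : ℝ) with hN
  set p := ‖gradient (primal g) z.fst‖ ^ 2 with hp
  set q₁ := ‖grad₁ g z‖ ^ 2 with hq₁
  set q₂ := ‖grad₂ g z‖ ^ 2 with hq₂
  have hstep : ∀ τ, potential 4 g (innerIterate v α β f τ z (Fin.last n))
      ≤ (potential 4 g z - α * n * p - 5 / 28 * (β * n) * q₂)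
        + β * n * (17 / 8 * (L ^ 2 / n)
          * (α ^ 2 * partialSums₁ f τ z + β ^ 2 * partialSums₂ f τ z)) := fun τ => by
    obtain ⟨e₁, e₂, hx, hy, he₁, he₂⟩ := exists_epoch_eq hn v hf
      (by rwa [abs_of_nonneg hα]) hLβ τ z
    refine potential_le_of_inexact_step hL hμ hμL hg hne hpl (by positivity)
      (by rw [← hαβ]; ring) hr ?_ hx hy he₁ he₂
    have h := abs_le_of_sq_le_sq (a := 6 * L * (β * n)) (b := 1) (by linarith) zero_le_one
    exact (le_abs_self _).trans h
  refine (Finset.sum_le_sum fun τ _ => hstep τ).trans ?_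
  rw [Finset.sum_add_distrib, Finset.sum_const, Finset.card_univ, nsmul_eq_mul, ← Finset.mul_sum,
    ← Finset.mul_sum, Finset.sum_add_distrib, ← Finset.mul_sum, ← Finset.mul_sum, ← hN]
  have hd := fun i => (hf i).1
  have hT₁ := mul_le_mul_of_nonneg_left (sum_partialSums₁_le hd hv z) (sq_nonneg α)
  have hT₂ := mul_le_mul_of_nonneg_left (sum_partialSums₂_le hd hv z) (sq_nonneg β)
  rw [← hN] at hT₁ hT₂
  have hcoef : 0 ≤ β * n * (17 / 8 * (L ^ 2 / n)) := by positivity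
  have hT := mul_le_mul_of_nonneg_left (add_le_add hT₁ hT₂) hcoef
  have hN0 : 0 ≤ N := Nat.cast_nonneg _
  have hakb : 14 * (α * κ ^ 2) ≤ β := by nlinarith
  have hkey := sampling_error_le hn' hA hB hα h14 hakb hβ (sq_nonneg _) (sq_nonneg _)
    (sq_nonneg _) (norm_sq_grad₁_le hL hμ hg hne hpl z)
  rw [← hp, ← hq₁, ← hq₂] at hkey
  have hkey' := mul_le_mul_of_nonneg_left hkey hN0
  linarith

end EpochDescent

/-! ### Independence of epochs and telescoping -/

section Epochs

variable {dx dy n K : ℕ}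

lemma epochStart_succ (v : Variant) (α β : ℝ) (f : Fin n → Z dx dy → ℝ)
    (σ : Fin K → Equiv.Perm (Fin n)) (z : Z dx dy) (k : Fin K) :
    epochStart v α β f σ z k.succ
      = innerIterate v α β f (σ k) (epochStart v α β f σ z k.castSucc) (Fin.last n) := rfl

/-- Adaptedness: the start of an epoch depends only on earlier permutations, so a fresh draw of the
current one leaves it unchanged. -/
lemma epochStart_congr (v : Variant) (α β : ℝ) (f : Fin n → Z dx dy → ℝ)
    {σ σ' : Fin K → Equiv.Perm (Fin n)} (z : Z dx dy) (i : Fin (K + 1))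
    (h : ∀ j : Fin K, j.castSucc < i → σ j = σ' j) :
    epochStart v α β f σ z i = epochStart v α β f σ' z i := by
  induction i using Fin.induction with
  | zero => rfl
  | succ k ih =>
    rw [epochStart_succ, epochStart_succ, h k (Fin.castSucc_lt_succ),
      ih fun j hj => h j (hj.trans Fin.castSucc_lt_succ)]

/-- Resampling one coordinate of a uniformly distributed tuple. -/
lemma sum_sum_update {ι κ : Type*} [Fintype ι] [DecidableEq ι] [Fintype κ]
    (F : (ι → κ) → ℝ) (k : ι) :
    ∑ σ, ∑ t, F (Function.update σ k t) = (Fintype.card κ : ℝ) * ∑ σ, F σ := by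
  -- Swapping the fresh value with the stored one is an involution on pairs.
  let e : (ι → κ) × κ ≃ (ι → κ) × κ :=
    { toFun := fun p => (Function.update p.1 k p.2, p.1 k)
      invFun := fun p => (Function.update p.1 k p.2, p.1 k)
      left_inv := fun p => by simp
      right_inv := fun p => by simp }
  rw [← Fintype.sum_prod_type']
  rw [Fintype.sum_equiv e (fun p : (ι → κ) × κ => F (Function.update p.1 k p.2))
    (fun p => F p.1) fun _ => rfl, Fintype.sum_prod_type]
  simp [Finset.mul_sum]

lemma expectRR_mono {X Y : (Fin K → Equiv.Perm (Fin n)) → ℝ} (h : ∀ σ, X σ ≤ Y σ) :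
    expectRR X ≤ expectRR Y :=
  div_le_div_of_nonneg_right (Finset.sum_le_sum fun σ _ => h σ) (Nat.cast_nonneg _)

lemma expectRR_const (c : ℝ) : expectRR (fun _ : Fin K → Equiv.Perm (Fin n) => c) = c := by
  have h : (Fintype.card (Fin K → Equiv.Perm (Fin n)) : ℝ) ≠ 0 :=
    Nat.cast_ne_zero.2 Fintype.card_ne_zero
  unfold expectRR
  rw [Finset.sum_const, Finset.card_univ, nsmul_eq_mul, mul_div_cancel_left₀ _ h]

/-- A one-epoch bound on conditional expectations integrates to a bound on expectations. -/
lemma expectRR_epochStart_succ_le (v : Variant) (α β : ℝ) (f : Fin n → Z dx dy → ℝ)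
    (z : Z dx dy) {G P : Z dx dy → ℝ} {c e : ℝ}
    (h : ∀ w, ∑ τ, G (innerIterate v α β f τ w (Fin.last n))
      ≤ (Fintype.card (Equiv.Perm (Fin n)) : ℝ) * (G w - c * P w + e)) (k : Fin K) :
    expectRR (fun σ : Fin K → Equiv.Perm (Fin n) => G (epochStart v α β f σ z k.succ))
      ≤ expectRR (fun σ : Fin K → Equiv.Perm (Fin n) => G (epochStart v α β f σ z k.castSucc))
        - c * expectRR (fun σ : Fin K → Equiv.Perm (Fin n) =>
          P (epochStart v α β f σ z k.castSucc)) + e := by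
  have hN : (0 : ℝ) < Fintype.card (Equiv.Perm (Fin n)) := Nat.cast_pos.2 Fintype.card_pos
  have hM : (0 : ℝ) < Fintype.card (Fin K → Equiv.Perm (Fin n)) := Nat.cast_pos.2 Fintype.card_pos
  have h1 : ∀ (σ : Fin K → Equiv.Perm (Fin n)) τ,
      epochStart v α β f (Function.update σ k τ) z k.succ
        = innerIterate v α β f τ (epochStart v α β f σ z k.castSucc) (Fin.last n) :=
    fun σ τ => by
      rw [epochStart_succ, Function.update_self, epochStart_congr (σ' := σ)]
      intro j hj
      exact Function.update_of_ne (fun hjk => by simp [hjk] at hj) _ _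
  have h2 := sum_sum_update
    (fun σ : Fin K → Equiv.Perm (Fin n) => G (epochStart v α β f σ z k.succ)) k
  simp only [h1] at h2
  have h3 := Finset.sum_le_sum fun (σ : Fin K → Equiv.Perm (Fin n)) (_ : σ ∈ Finset.univ) =>
    h (epochStart v α β f σ z k.castSucc)
  rw [h2, ← Finset.mul_sum] at h3
  have h4 := le_of_mul_le_mul_left h3 hN
  rw [Finset.sum_add_distrib, Finset.sum_sub_distrib, ← Finset.mul_sum, Finset.sum_const,
    Finset.card_univ, nsmul_eq_mul] at h4
  unfold expectRR
  rw [div_le_iff₀ hM]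
  refine h4.trans (le_of_eq ?_)
  field_simp

/-- The one-epoch bounds telescope, and the final expected potential is dropped because it is
non-negative. -/
lemma sum_expectRR_le (v : Variant) (α β : ℝ) (f : Fin n → Z dx dy → ℝ)
    (z : Z dx dy) {G P : Z dx dy → ℝ} {c e : ℝ} (hG : ∀ w, 0 ≤ G w)
    (h : ∀ w, ∑ τ, G (innerIterate v α β f τ w (Fin.last n))
      ≤ (Fintype.card (Equiv.Perm (Fin n)) : ℝ) * (G w - c * P w + e)) :
    c * ∑ k : Fin K, expectRR (fun σ : Fin K → Equiv.Perm (Fin n) =>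
      P (epochStart v α β f σ z k.castSucc)) ≤ G z + K * e := by
  set V : Fin (K + 1) → ℝ := fun i =>
    expectRR (fun σ : Fin K → Equiv.Perm (Fin n) => G (epochStart v α β f σ z i)) with hV
  have h0 : V 0 = G z := expectRR_const (G z)
  have hlast : 0 ≤ V (Fin.last K) :=
    (expectRR_const (n := n) (K := K) 0).symm.le.trans (expectRR_mono fun σ => hG _)
  have h1 := Finset.sum_le_sum fun (k : Fin K) (_ : k ∈ Finset.univ) =>
    expectRR_epochStart_succ_le v α β f z h k
  rw [Finset.sum_add_distrib, Finset.sum_sub_distrib, ← Finset.mul_sum, Finset.sum_const,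
    Finset.card_univ, Fintype.card_fin, nsmul_eq_mul] at h1
  have h2 : ∑ i : Fin K, V i.succ ≤ ∑ i : Fin K, V i.castSucc - _ + _ := h1
  have h3 := Fin.sum_univ_castSucc V
  have h4 := Fin.sum_univ_succ V
  linarith

lemma step_zero_zero (v : Variant) (g : Z dx dy → ℝ) (z : Z dx dy) : step v 0 0 g z = z := by
  cases v <;> simp [step] <;> rfl

lemma innerIterate_zero_zero (v : Variant) (f : Fin n → Z dx dy → ℝ) (τ : Equiv.Perm (Fin n))
    (z : Z dx dy) (i : Fin (n + 1)) : innerIterate v 0 0 f τ z i = z := by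
  induction i using Fin.induction with
  | zero => rfl
  | succ i ih => rw [innerIterate_succ, ih, step_zero_zero]

lemma epochStart_zero_zero (v : Variant) (f : Fin n → Z dx dy → ℝ)
    (σ : Fin K → Equiv.Perm (Fin n)) (z : Z dx dy) (i : Fin (K + 1)) :
    epochStart v 0 0 f σ z i = z := by
  induction i using Fin.induction with
  | zero => rfl
  | succ i ih => rw [epochStart_succ, ih, innerIterate_zero_zero]

end Epochs

/-! ### Convergence rate and gradient complexity -/

section Rates

variable {dx dy n : ℕ}

lemma potential_nonneg {g : Z dx dy → ℝ} (hp : PrimalWellDefined g) (z : Z dx dy) :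
    0 ≤ potential 4 g z := by
  have h1 : primalInf g ≤ primal g z.fst := ciInf_le hp.2 z.fst
  have h2 : g z ≤ primal g z.fst := le_primal (fun x => (hp.1 x).1) z.fst z.snd
  unfold potential
  linarith

/-- Both summands of the potential are non-negative, so a zero value makes `z.fst` a global
minimizer of `Φ`. This settles the case where the prescribed stepsize is zero. -/
lemma gradient_primal_eq_zero_of_potential_eq_zero {g : Z dx dy → ℝ} (hp : PrimalWellDefined g)
    {z : Z dx dy} (h : potential 4 g z = 0) : gradient (primal g) z.fst = 0 := by
  have h1 : primalInf g ≤ primal g z.fst := ciInf_le hp.2 z.fst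
  have h2 : g z ≤ primal g z.fst := le_primal (fun x => (hp.1 x).1) z.fst z.snd
  have hmin : IsLocalMin (primal g) z.fst := Filter.Eventually.of_forall fun x => by
    have h3 : primalInf g ≤ primal g x := ciInf_le hp.2 x
    unfold potential at h
    linarith
  rw [gradient, hmin.fderiv_eq_zero, map_zero]

/-- Bound on the averaged squared gradient for an arbitrary admissible stepsize. -/
lemma avgSqGradPrimal_le {K : ℕ} {L A B μ r β : ℝ} {f : Fin n → Z dx dy → ℝ} (hn : 0 < n)
    (hK : 0 < K) (hL : 0 < L) (hA : 0 ≤ A) (hB : 0 ≤ B) (hμ : 0 < μ) (hμL : μ ≤ L)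
    (hf : ∀ i, IsSmooth L (f i)) (hv : BoundedVariance A B f)
    (hp : PrimalWellDefined (objective f)) (hpl : PLInY μ (objective f))
    (hr : 14 * (L / μ) ^ 2 ≤ r) (hβ0 : 0 < β)
    (hβ : 36 * L ^ 2 * β ^ 2 * (n * (n + A)) ≤ 1) (v : Variant) (z : Z dx dy) :
    avgSqGradPrimal K v (β / r) β f z
      ≤ 2 * r * potential 4 (objective f) z / (n * K) * (1 / β)
        + 10 * r * (n * β ^ 2 * (L ^ 2 * B)) := by
  have hn' : (0 : ℝ) < n := Nat.cast_pos.2 hn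
  have hK' : (0 : ℝ) < K := Nat.cast_pos.2 hK
  have hr0 : 0 < r := lt_of_lt_of_le (by positivity) hr
  have h := sum_expectRR_le (K := K) v (β / r) β f z (potential_nonneg hp)
    (c := β / r * n / 2) (P := fun w => ‖gradient (primal (objective f)) w.fst‖ ^ 2)
    (fun w => sum_potential_epoch_le hn hL hA hB hμ hμL hf hv (fun x => (hp.1 x).1) hpl hr
      (α := β / r) (by positivity) (mul_div_cancel₀ _ hr0.ne') hβ v w)
  unfold avgSqGradPrimal
  set S := ∑ k : Fin K, expectRR fun σ : Fin K → Equiv.Perm (Fin n) =>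
      ‖gradient (primal (objective f)) (epochStart v (β / r) β f σ z k.castSucc).fst‖ ^ 2
  have hS : S ≤ 2 * r / (β * n) * (potential 4 (objective f) z
      + K * (5 * L ^ 2 * (n : ℝ) ^ 2 * β ^ 3 * B)) := by
    have h1 := mul_le_mul_of_nonneg_left h (show 0 ≤ 2 * r / (β * n) by positivity)
    refine le_trans (le_of_eq ?_) h1
    field_simp
  refine (mul_le_mul_of_nonneg_left hS (by positivity)).trans (le_of_eq ?_)
  field_simp
  ring

lemma cube_rpow_third {a : ℝ} (ha : 0 ≤ a) : (a ^ (1 / 3 : ℝ)) ^ 3 = a := by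
  rw [← Real.rpow_natCast, ← Real.rpow_mul ha]
  norm_num

lemma sqrt_mul_add_div {n A : ℝ} (hn : 0 < n) : √(n * (n + A)) / n = √(1 + A / n) := by
  rw [show 1 + A / n = n * (n + A) / n ^ 2 by field_simp, Real.sqrt_div' _ (sq_nonneg n),
    Real.sqrt_sq hn.le]

lemma admissible_of_le {n L A β : ℝ} (hn : 0 < n) (hL : 0 < L) (hA : 0 ≤ A) (hβ0 : 0 ≤ β)
    (hβ : β ≤ 1 / (6 * L * √(n * (n + A)))) : 36 * L ^ 2 * β ^ 2 * (n * (n + A)) ≤ 1 := by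
  have hpos : 0 < n * (n + A) := by positivity
  have hs : 0 < √(n * (n + A)) := Real.sqrt_pos.2 hpos
  rw [le_div_iff₀ (by positivity)] at hβ
  have h := pow_le_pow_left₀ (by positivity) hβ 2
  rw [mul_pow, mul_pow, Real.sq_sqrt hpos.le] at h
  linarith

lemma stepSizeY_le {c L A B V : ℝ} {n K : ℕ} :
    stepSizeY c L A B V n K ≤ 1 / (6 * L * √((n : ℝ) * (n + A))) := by
  unfold stepSizeY
  split_ifs
  · exact le_rfl
  · exact min_le_left _ _

/-- Inserting the prescribed stepsize into the bound for an arbitrary one. -/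
lemma rate_of_stepSizeY {c L A B V r S : ℝ} {n K : ℕ} (hc : 0 < c) (hn : 0 < n) (hK : 0 < K)
    (hL : 0 < L) (hA : 0 ≤ A) (hB : 0 ≤ B) (hV : 0 ≤ V) (hVB : V = 0 → B = 0) (hr : 0 < r)
    (hS : S ≤ 2 * r * V / (n * K) * (1 / stepSizeY c L A B V n K)
        + 10 * r * (n * stepSizeY c L A B V n K ^ 2 * (L ^ 2 * B))) :
    S ≤ (12 + 2 / c + 10 * c ^ 2) * (r * L * V / K * √(1 + A / n)
      + r * (L ^ 2 * B * V ^ 2 / (n * (K : ℝ) ^ 2)) ^ (1 / 3 : ℝ)) := by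
  have hn' : (0 : ℝ) < n := Nat.cast_pos.2 hn
  have hK' : (0 : ℝ) < K := Nat.cast_pos.2 hK
  set b₁ := 1 / (6 * L * √((n : ℝ) * (n + A))) with hb₁
  set T := r * L * V / K * √(1 + A / n) with hT
  have hs : 0 < √((n : ℝ) * (n + A)) := Real.sqrt_pos.2 (by positivity)
  have hb₁0 : 0 < b₁ := by positivity
  have hT0 : 0 ≤ T := by positivity
  have hfirst : 2 * r * V / (n * K) * (1 / b₁) = 12 * T := by
    rw [hT, ← sqrt_mul_add_div hn', hb₁]
    field_simp
    ring
  have hcoef : 0 ≤ 2 * r * V / (n * K) := by positivity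
  by_cases hB0 : B = 0
  · simp only [stepSizeY, if_pos hB0, ← hb₁] at hS
    subst hB0
    rw [hfirst] at hS
    have h1 : 0 ≤ (2 / c + 10 * c ^ 2) * T := by positivity
    have h2 : (L ^ 2 * 0 * V ^ 2 / (n * (K : ℝ) ^ 2)) ^ (1 / 3 : ℝ) = 0 := by
      rw [mul_zero, zero_mul, zero_div, Real.zero_rpow (by norm_num)]
    rw [h2]
    linarith
  · have hBpos : 0 < B := lt_of_le_of_ne hB (Ne.symm hB0)
    have hVpos : 0 < V := lt_of_le_of_ne hV fun h => hB0 (hVB h.symm)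
    simp only [stepSizeY, if_neg hB0, ← hb₁] at hS
    have hq3 := cube_rpow_third (a := V / (L ^ 2 * B * (n : ℝ) ^ 2 * K)) (by positivity)
    have ht3 := cube_rpow_third (a := L ^ 2 * B * V ^ 2 / (n * (K : ℝ) ^ 2)) (by positivity)
    have hq0 : 0 < (V / (L ^ 2 * B * (n : ℝ) ^ 2 * K)) ^ (1 / 3 : ℝ) := by positivity
    have ht0 : 0 < (L ^ 2 * B * V ^ 2 / (n * (K : ℝ) ^ 2)) ^ (1 / 3 : ℝ) := by positivity
    set q := (V / (L ^ 2 * B * (n : ℝ) ^ 2 * K)) ^ (1 / 3 : ℝ)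
    set t := (L ^ 2 * B * V ^ 2 / (n * (K : ℝ) ^ 2)) ^ (1 / 3 : ℝ)
    -- `q` is the balancing stepsize: the noise `n q² L² B` and the optimization term `V / (nKq)`
    -- both equal `t`.
    have hqt : n * q ^ 2 * (L ^ 2 * B) = t := by
      refine (pow_left_inj₀ (by positivity) ht0.le (three_ne_zero)).1 ?_
      rw [ht3, show (n * q ^ 2 * (L ^ 2 * B)) ^ 3
        = (n : ℝ) ^ 3 * (q ^ 3) ^ 2 * (L ^ 2 * B) ^ 3 by ring, hq3]
      field_simp
    have hqV : V / (n * K * q) = t := by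
      rw [← hqt, div_eq_iff (by positivity)]
      rw [show n * q ^ 2 * (L ^ 2 * B) * (n * K * q)
        = q ^ 3 * (L ^ 2 * B * (n : ℝ) ^ 2 * K) by ring, hq3]
      field_simp
    set β := min b₁ (c * q) with hβ
    have hβ0 : 0 < β := lt_min hb₁0 (by positivity)
    -- Bounding the inverse of a minimum by the sum of inverses avoids separate rates for the two
    -- regimes.
    have hinv : 1 / β ≤ 1 / b₁ + 1 / (c * q) := by
      rcases min_choice b₁ (c * q) with h | h
      · rw [hβ, h]; linarith [show 0 < 1 / (c * q) by positivity]
      · rw [hβ, h]; linarith [show 0 < 1 / b₁ by positivity]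
    have h1 := mul_le_mul_of_nonneg_left hinv hcoef
    have h2 : 2 * r * V / (n * K) * (1 / (c * q)) = 2 / c * (r * t) := by
      rw [← hqV]; field_simp
    rw [mul_add, hfirst, h2] at h1
    have h3 : n * β ^ 2 * (L ^ 2 * B) ≤ c ^ 2 * t := by
      have h4 := pow_le_pow_left₀ hβ0.le (min_le_right b₁ (c * q)) 2
      have h5 := mul_le_mul_of_nonneg_left h4 (show 0 ≤ n * (L ^ 2 * B) by positivity)
      rw [← hqt]
      linarith
    have h6 := mul_le_mul_of_nonneg_left h3 (show 0 ≤ 10 * r by positivity)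
    have h7 : 0 ≤ (2 / c + 10 * c ^ 2) * T := by positivity
    have h8 : 0 ≤ 12 * (r * t) := by positivity
    linarith

/-- From the convergence rate to the number of gradient evaluations. -/
lemma le_sq_of_complexity {C₀ L A B V r ε : ℝ} {n K : ℕ} (hC : 1 ≤ C₀) (hn : 0 < n) (hK : 0 < K)
    (hL : 0 < L) (hB : 0 ≤ B) (hV : 0 ≤ V) (hr : 0 < r) (hε : 0 < ε)
    (h : 8 * C₀ ^ 3 * (r * L * V / ε ^ 2 * max √((n : ℝ) ^ 2 + n * A) (√(r * n * B) / ε))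
      ≤ (gradEvals n K : ℝ)) :
    C₀ * (r * L * V / K * √(1 + A / n)
      + r * (L ^ 2 * B * V ^ 2 / (n * (K : ℝ) ^ 2)) ^ (1 / 3 : ℝ)) ≤ ε ^ 2 := by
  have hn' : (0 : ℝ) < n := Nat.cast_pos.2 hn
  have hK' : (0 : ℝ) < K := Nat.cast_pos.2 hK
  have hC0 : 0 < C₀ := by linarith
  rw [gradEvals, Nat.cast_mul] at h
  have hcoef : 0 ≤ 8 * C₀ ^ 3 * (r * L * V / ε ^ 2) := by positivity
  have h1 := (mul_le_mul_of_nonneg_left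
    (le_max_left √((n : ℝ) ^ 2 + n * A) (√(r * n * B) / ε)) hcoef).trans
    ((mul_assoc _ _ _).trans_le h)
  have h2 := (mul_le_mul_of_nonneg_left
    (le_max_right √((n : ℝ) ^ 2 + n * A) (√(r * n * B) / ε)) hcoef).trans
    ((mul_assoc _ _ _).trans_le h)
  have hT : 8 * C₀ ^ 3 * (r * L * V / K * √(1 + A / n)) ≤ ε ^ 2 := by
    rw [← sqrt_mul_add_div hn', show (n : ℝ) * (n + A) = (n : ℝ) ^ 2 + n * A by ring]
    have e : 8 * C₀ ^ 3 * (r * L * V / K * (√((n : ℝ) ^ 2 + n * A) / n))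
        = 8 * C₀ ^ 3 * (r * L * V / ε ^ 2) * √((n : ℝ) ^ 2 + n * A) * (ε ^ 2 / (n * K)) := by
      field_simp
    rw [e]
    refine (mul_le_mul_of_nonneg_right h1 (by positivity)).trans (le_of_eq ?_)
    field_simp
  have ht3 := cube_rpow_third (a := L ^ 2 * B * V ^ 2 / (n * (K : ℝ) ^ 2)) (by positivity)
  have ht0 : 0 ≤ (L ^ 2 * B * V ^ 2 / (n * (K : ℝ) ^ 2)) ^ (1 / 3 : ℝ) := by positivity
  set t := (L ^ 2 * B * V ^ 2 / (n * (K : ℝ) ^ 2)) ^ (1 / 3 : ℝ)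
  -- Cubing removes the cube root: `(4C₀²)³ = (8C₀³)²`, which is why the constant in the hypothesis
  -- is `8C₀³`. The two terms of the rate then contribute at most `ε²/8` and `ε²/4`.
  have ht : 4 * C₀ ^ 2 * (r * t) ≤ ε ^ 2 := by
    refine (pow_le_pow_iff_left₀ (by positivity) (by positivity) three_ne_zero).1 ?_
    have h3 := pow_le_pow_left₀ (by positivity) h2 2
    rw [mul_pow, div_pow, Real.sq_sqrt (by positivity)] at h3
    have e : (4 * C₀ ^ 2 * (r * t)) ^ 3
        = (8 * C₀ ^ 3 * (r * L * V / ε ^ 2)) ^ 2 * (r * n * B / ε ^ 2)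
          * ((ε ^ 2) ^ 3 / (n * K) ^ 2) := by
      rw [show (4 * C₀ ^ 2 * (r * t)) ^ 3 = 64 * C₀ ^ 6 * r ^ 3 * t ^ 3 by ring, ht3]
      field_simp
      ring
    rw [e]
    refine (mul_le_mul_of_nonneg_right h3 (by positivity)).trans (le_of_eq ?_)
    field_simp
  have hT0 : 0 ≤ r * L * V / K * √(1 + A / n) := by positivity
  have h4 : C₀ ≤ C₀ ^ 3 := le_self_pow₀ hC three_ne_zero
  have h5 : C₀ ≤ C₀ ^ 2 := le_self_pow₀ hC two_ne_zero
  have h6 := mul_le_mul_of_nonneg_right h4 hT0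
  have h7 := mul_le_mul_of_nonneg_right h5 (show 0 ≤ r * t by positivity)
  linarith [sq_nonneg ε]

lemma max_complexity_le {L A B V r ε n : ℝ} (hn : 1 ≤ n) (hL : 0 < L) (hA : 0 ≤ A) (hV : 0 ≤ V)
    (hr : 0 < r) (hε : 0 < ε) :
    r * L * V / ε ^ 2 * max √(n ^ 2 + n * A) (√(r * n * B) / ε)
      ≤ V * (√(1 + A) * (n * r * L / ε ^ 2) + √B * (√n * r ^ (3 / 2 : ℝ) * L / ε ^ 3)) := by
  have hn0 : 0 < n := by linarith
  -- Here `n ≥ 1` is needed, for `nA ≤ n²A`.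
  have h1 : √(n ^ 2 + n * A) ≤ √(1 + A) * n := by
    rw [Real.sqrt_le_left (by positivity), mul_pow, Real.sq_sqrt (by linarith)]
    nlinarith [mul_nonneg (mul_nonneg hn0.le hA) (sub_nonneg.2 hn)]
  have h2 : √(r * n * B) = √r * √n * √B := by
    rw [Real.sqrt_mul (by positivity), Real.sqrt_mul hr.le]
  have h3 : r ^ (3 / 2 : ℝ) = r * √r := by
    rw [show (3 / 2 : ℝ) = 1 + 1 / 2 by norm_num, Real.rpow_add hr, Real.rpow_one,
      Real.sqrt_eq_rpow]
  have h4 : max √(n ^ 2 + n * A) (√(r * n * B) / ε) ≤ √(1 + A) * n + √r * √n * √B / ε := by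
    rw [h2]
    refine max_le ?_ ?_
    · have : 0 ≤ √r * √n * √B / ε := by positivity
      linarith
    · have : 0 ≤ √(1 + A) * n := by positivity
      linarith
  refine (mul_le_mul_of_nonneg_left h4 (by positivity)).trans (le_of_eq ?_)
  rw [h3]
  field_simp

end Rates

end SGDARR

theorem theorem1 (c : ℝ) (hc : 0 < c) :
    ∃ C : ℝ, 0 < C ∧
      ∀ (dx dy n K : ℕ) (v : SGDARR.Variant) (f : Fin n → SGDARR.Z dx dy → ℝ)
        (L A B μ₂ r : ℝ) (z₁ : SGDARR.Z dx dy),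
        0 < n → 0 < K → 0 < L → 0 ≤ A → 0 ≤ B → 0 < μ₂ →
        (∀ i, SGDARR.IsSmooth L (f i)) →
        SGDARR.BoundedVariance A B f →
        SGDARR.PrimalWellDefined (SGDARR.objective f) →
        SGDARR.PLInY μ₂ (SGDARR.objective f) →
        -- if `f` does not depend on `y`, every `μ₂` is a PŁ constant: take one with `L / μ₂ ≥ 1`
        ((∀ x y y', SGDARR.objective f (SGDARR.pt x y) = SGDARR.objective f (SGDARR.pt x y')) →
          μ₂ ≤ L) →
        14 * (L / μ₂) ^ 2 ≤ r →
        let V : ℝ := SGDARR.potential 4 (SGDARR.objective f) z₁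
        let β : ℝ := SGDARR.stepSizeY c L A B V n K
        let α : ℝ := β / r
        let S : ℝ := SGDARR.avgSqGradPrimal K v α β f z₁
        Differentiable ℝ (SGDARR.primal (SGDARR.objective f)) ∧
        S ≤ C * (r * L * V / K * √(1 + A / n)
              + r * (L ^ 2 * B * V ^ 2 / (n * (K : ℝ) ^ 2)) ^ (1 / 3 : ℝ)) ∧
        (∀ ε : ℝ, 0 < ε →
          C * (r * L * V / ε ^ 2 * max √((n : ℝ) ^ 2 + n * A) (√(r * n * B) / ε))
              ≤ (SGDARR.gradEvals n K : ℝ) →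
          S ≤ ε ^ 2) ∧
        (∀ ε : ℝ, 0 < ε →
          C * V * (√(1 + A) * (n * r * L / ε ^ 2)
              + √B * (√n * r ^ (3 / 2 : ℝ) * L / ε ^ 3)) ≤ (SGDARR.gradEvals n K : ℝ) →
          S ≤ ε ^ 2) := by
  open SGDARR in
  -- In `C₀ = 12 + 2/c + 10c²` the summands come from the first entry of `β`, the second entry, and
  -- the noise; `8C₀³` serves the rate and both complexity bounds.
  refine ⟨8 * (12 + 2 / c + 10 * c ^ 2) ^ 3, by positivity, ?_⟩
  intro dx dy n K v f L A B μ₂ r z₁ hn hK hL hA hB hμ hf hv hp hpl hconst hr V β α S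
  set C₀ : ℝ := 12 + 2 / c + 10 * c ^ 2 with hC₀
  have hC : 1 ≤ C₀ := by
    have : 0 ≤ 2 / c + 10 * c ^ 2 := by positivity
    linarith
  have hn1 : (1 : ℝ) ≤ n := Nat.one_le_cast.2 hn
  have hg := isSmooth_objective hn hf
  have hne : ∀ x, (argmaxY (objective f) x).Nonempty := fun x => (hp.1 x).1
  have hμL : μ₂ ≤ L := le_of_plInY hL hg hne hpl hconst
  have hr0 : 0 < r := lt_of_lt_of_le (by positivity) hr
  have hV : 0 ≤ V := potential_nonneg hp z₁
  have hβ0 : 0 ≤ β := by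
    have h1 : 0 ≤ 1 / (6 * L * √((n : ℝ) * (n + A))) := by positivity
    simp only [β, stepSizeY]
    split_ifs
    · exact h1
    · exact le_min h1 (by positivity)
  have hrate : S ≤ C₀ * (r * L * V / K * √(1 + A / n)
      + r * (L ^ 2 * B * V ^ 2 / (n * (K : ℝ) ^ 2)) ^ (1 / 3 : ℝ)) := by
    -- If `V = 0` and `B ≠ 0`, the stepsize is zero and division by it is meaningless; the iterates
    -- stay at `z₁`, where `∇Φ` vanishes.
    by_cases hdeg : V = 0 ∧ B ≠ 0
    · have hβ : β = 0 := by
        refine le_antisymm ?_ hβ0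
        simp only [β, stepSizeY, if_neg hdeg.2]
        refine (min_le_right _ _).trans_eq ?_
        rw [hdeg.1, zero_div, Real.zero_rpow (by norm_num), mul_zero]
      have hS : S = 0 := by
        simp only [S, α, hβ, zero_div, avgSqGradPrimal, epochStart_zero_zero, expectRR_const,
          gradient_primal_eq_zero_of_potential_eq_zero hp hdeg.1]
        simp
      rw [hS]
      positivity
    · have hVB : V = 0 → B = 0 := fun h => not_not.1 fun hB0 => hdeg ⟨h, hB0⟩
      have hβpos : 0 < β := by
        have hs : 0 < √((n : ℝ) * (n + A)) := Real.sqrt_pos.2 (by positivity)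
        have hK' : (0 : ℝ) < K := Nat.cast_pos.2 hK
        simp only [β, stepSizeY]
        split_ifs with hB0
        · positivity
        · have hVpos : 0 < V := lt_of_le_of_ne hV fun h => hB0 (hVB h.symm)
          have hBpos : 0 < B := lt_of_le_of_ne hB (Ne.symm hB0)
          exact lt_min (by positivity) (by positivity)
      exact rate_of_stepSizeY hc hn hK hL hA hB hV hVB hr0
        (avgSqGradPrimal_le hn hK hL hA hB hμ hμL hf hv hp hpl hr hβpos
          (admissible_of_le (by positivity) hL hA hβ0 stepSizeY_le) v z₁)
  have hcomplexity : ∀ ε : ℝ, 0 < ε →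
      8 * C₀ ^ 3 * (r * L * V / ε ^ 2 * max √((n : ℝ) ^ 2 + n * A) (√(r * n * B) / ε))
        ≤ (gradEvals n K : ℝ) → S ≤ ε ^ 2 := fun ε hε h =>
    hrate.trans (le_sq_of_complexity hC hn hK hL hB hV hr0 hε h)
  refine ⟨differentiable_primal hL hμ hg hne hpl, hrate.trans ?_, hcomplexity, ?_⟩
  · refine mul_le_mul_of_nonneg_right ?_ (by positivity)
    have := le_self_pow₀ hC three_ne_zero
    linarith
  · intro ε hε h
    refine hcomplexity ε hε (le_trans ?_ h)
    rw [mul_assoc (8 * C₀ ^ 3) V]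
    exact mul_le_mul_of_nonneg_left (max_complexity_le hn1 hL hA hV hr0 hε) (by positivity)
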